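/- Let $\Lambda=\{\lambda_1,\dots,\lambda_n\}$ be a set of $n$ distinct real numbers that is strongly disjoint: for any two nonempty disjoint subsets $A,B\subseteq\Lambda$ the means differ, $\mu(A)\neq\mu(B)$, where $\mu(A)=\frac1{\#A}\sum_{x\in A}x$. Let $\mathrm{Sym}(\Lambda)$ be the manifold of real symmetric $n\times n$ matrices with eigenvalue set $\Lambda$. Its tangent space at $H$ is $\{[H,\Omega]:\Omega^T=-\Omega\}$; equip it with the normal metric $g([H,\Omega_1],[H,\Omega_2])=-\mathrm{tr}(\Omega_1\Omega_2)$. Let $\mathcal H=\nabla^2\Psi$ be the Riemannian Hessian, with respect to the Levi-Civita connection of $g$, of the diagonal potential $\Psi(H)=\frac12\sum_{i}d_i^2$, where $d_1,\dots,d_n$ are the diagonal entries of $H$. For an ordered partition $\alpha=(\Lambda_1,\dots,\Lambda_k)$ of $\Lambda$ into nonempty sets, with $n_i=\#\Lambda_i$, let $$E_\alpha=\{\mathrm{Diag}(H_1,\dots,H_k)\;:\;H_i\in\mathrm{Sym}(\Lambda_i)\text{ and all diagonal entries of }H_i\text{ equal }\mu(\Lambda_i)\}.$$ The sets $P^TE_\alpha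 P$ with $P$ a permutation matrix are called critical manifolds. For a submanifold $E$ of $\mathrm{Sym}(\Lambda)$ and $H\in E$, let $N_HE$ be the $g$-orthogonal complement of $T_HE$ in $T_H\mathrm{Sym}(\Lambda)$. **Theorem.** 1. For every $\alpha$ and every $H\in E_\alpha$, the restriction of $\mathcal H$ to $N_HE_\alpha$ is nondegenerate. 2. More precisely, let $H=\mathrm{Diag}(H_1,\dots,H_k)\in E_\alpha$. For each $p$ let $\lambda_{p1}<\dots<\lambda_{pn_p}$ be the elements of $\Lambda_p$, let $v_{p1},\dots,v_{pn_p}$ be unit eigenvectors of $H_p$ for these eigenvalues, and let $u_{p,1},\dots,u_{p,n_p-1}$ be an orthonormal basis of the hyperplane $(1,\dots,1)^\perp\subset\mathbb R^{n_p}$. For $p<q$, $1\le i\le n_p$, $1\le j\le n_q$ let $N_{pq,ij}$ be the symmetric matrix whose $pq$-th block is $(\lambda_{pi}-\lambda_{qj})v_{pi}v_{qj}^T$, whose $qp$-th block is the transpose of this, and whose other blocks vanish. Then there are skew symmetric $n_p\times n_p$ matrices $\Omega_{p,t}$ ($1\le p\le k$, $1\le t\le n_p-1$) such that the diagonal of $[H_p,\Omega_{p,t}]$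 is $u_{p,t}$ and such that, with $N_{p,t}$ the block-diagonal matrix with $p$-th diagonal block $[H_p,\Omega_{p,t}]$ and other blocks zero, the family $\mathcal N_o\cup\mathcal N_d=\{N_{pq,ij}\}\cup\{N_{p,t}\}$ is a basis of $N_HE_\alpha$ that is orthogonal with respect to $\mathcal H$, with $$\mathcal H(N_{pq,ij},N_{pq,ij})=-2(\lambda_{pi}-\lambda_{qj})(\mu(\Lambda_p)-\mu(\Lambda_q))\neq0,\qquad \mathcal H(N_{p,t},N_{p,t})=1.$$ 3. $\mathcal H$ is invariant under conjugation by permutation matrices: $\mathcal H_{P^THP}(P^TXP,P^TYP)=\mathcal H_H(X,Y)$ for every permutation matrix $P$, every $H\in\mathrm{Sym}(\Lambda)$ and all $X,Y\in T_H\mathrm{Sym}(\Lambda)$. Consequently $\mathcal H$ is also nondegenerate on the normal space at every point of every critical manifold $P^TE_\alpha P$. 4. $\Psi$ is a Morse–Bott function on $(\mathrm{Sym}(\Lambda),g)$: the set of zeros of $\mathrm{grad}\,\Psi$ is a finite disjoint union of connected embedded submanifolds $E_1,\dots,E_m$, and the Hessian of $\Psi$ is nondegenerate on $N_HE_i$ for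 all $i$ and all $H\in E_i$. -/

import Mathlib

open Matrix Polynomial
open scoped Topology ContDiff Matrix.Norms.Frobenius

noncomputable section

namespace DiagPotential

/-! ### Embedded submanifolds of a vector space -/

section Submanifold

variable {V : Type*} [NormedAddCommGroup V] [NormedSpace ℝ V]

/-- `S` is an embedded smooth `d`-dimensional submanifold of `V` (slice charts): near each of
its points some smooth diffeomorphism between open subsets of `V` carries `S` to a `d`-dimensional
linear subspace. -/
def IsSubmanifold (S : Set V) (d : ℕ) : Prop :=
  ∀ x ∈ S, ∃ (Φ : OpenPartialHomeomorph V V) (L : Submodule ℝ V),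
    x ∈ Φ.source ∧ ContDiffOn ℝ ∞ Φ Φ.source ∧ ContDiffOn ℝ ∞ Φ.symm Φ.target ∧
    Module.finrank ℝ L = d ∧ ∀ y ∈ Φ.source, (y ∈ S ↔ Φ y ∈ L)

/-- The tangent space of a submanifold `S` at `x`, as a subspace of `V`: the (span of the)
velocities at time `0` of the smooth curves in `S` through `x`. -/
def tangentSpaceAt (S : Set V) (x : V) : Submodule ℝ V :=
  Submodule.span ℝ {v | ∃ γ : ℝ → V, ContDiffAt ℝ ∞ γ 0 ∧ γ 0 = x ∧
    (∀ᶠ t in 𝓝 (0 : ℝ), γ t ∈ S) ∧ deriv γ 0 = v}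

end Submanifold

/-! ### The isospectral manifold -/

/-- The arithmetic mean `μ(A)` of a finite set of real numbers. -/
def mean (A : Finset ℝ) : ℝ := (∑ x ∈ A, x) / (A.card : ℝ)

/-- Disjoint nonempty subsets of `Λ` have different means. -/
def StronglyDisjoint (Λ : Finset ℝ) : Prop :=
  ∀ A B : Finset ℝ, A ⊆ Λ → B ⊆ Λ → A.Nonempty → B.Nonempty → Disjoint A B → mean A ≠ mean B

/-- Square matrices whose size is the number of elements of `Λ`. -/
abbrev Mat (Λ : Finset ℝ) : Type := Matrix (Fin Λ.card) (Fin Λ.card) ℝ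

/-- The isospectral manifold `Sym(Λ)`: the real symmetric matrices of size `#Λ` whose eigenvalues
are the elements of `Λ`, each of them simple. -/
def isoSym (Λ : Finset ℝ) : Set (Mat Λ) :=
  {H | Hᵀ = H ∧ H.charpoly = ∏ l ∈ Λ, (X - C l)}

section Geometry

variable {n : ℕ}

/-- `Ω` is skew symmetric. -/
def IsSkew (Ω : Matrix (Fin n) (Fin n) ℝ) : Prop := Ωᵀ = -Ω

/-- The tangent space of the isospectral manifold at `H`: all `[H, Ω]` with `Ω` skew symmetric. -/
def isoTangent (H : Matrix (Fin n) (Fin n) ℝ) : Set (Matrix (Fin n) (Fin n) ℝ) :=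
  {X | ∃ Ω, IsSkew Ω ∧ ⁅H, Ω⁆ = X}

open Classical in
/-- The skew symmetric `Ω` with `[H, Ω] = X`, for a tangent vector `X` at `H`; it is unique
when the eigenvalues of the symmetric matrix `H` are distinct. -/
def adInv (H X : Matrix (Fin n) (Fin n) ℝ) : Matrix (Fin n) (Fin n) ℝ :=
  if h : ∃ Ω, IsSkew Ω ∧ ⁅H, Ω⁆ = X then h.choose else 0

/-- The normal metric `g([H, Ω₁], [H, Ω₂]) = -tr(Ω₁ Ω₂)`. -/
def normalMetric (H X Y : Matrix (Fin n) (Fin n) ℝ) : ℝ :=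
  -(adInv H X * adInv H Y).trace

/-- The vector field `A ↦ [A, Ω]`. -/
def fundField (Ω A : Matrix (Fin n) (Fin n) ℝ) : Matrix (Fin n) (Fin n) ℝ := ⁅A, Ω⁆

/-- The curve `t ↦ exp(-tΩ) H exp(tΩ)` through `H`, with velocity `[H, Ω]` at `t = 0`. -/
def orbitCurve (H Ω : Matrix (Fin n) (Fin n) ℝ) (t : ℝ) : Matrix (Fin n) (Fin n) ℝ :=
  NormedSpace.exp (-(t • Ω)) * H * NormedSpace.exp (t • Ω)

/-- The derivative at `H` of a (real or matrix valued) function on the isospectral manifold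
in the direction of the tangent vector `X`, taken along a curve in the manifold with velocity `X`
at `H`. -/
def dirDeriv {E : Type*} [NormedAddCommGroup E] [NormedSpace ℝ E]
    (F : Matrix (Fin n) (Fin n) ℝ → E) (H X : Matrix (Fin n) (Fin n) ℝ) : E :=
  deriv (fun t : ℝ => F (orbitCurve H (adInv H X) t)) 0

/-- `W` is the gradient of `f` at `H` for the normal metric. -/
def IsGradientAt (f : Matrix (Fin n) (Fin n) ℝ → ℝ) (H W : Matrix (Fin n) (Fin n) ℝ) : Prop :=
  W ∈ isoTangent H ∧ ∀ Z ∈ isoTangent H, normalMetric H W Z = dirDeriv f H Z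

/-- The Lie bracket of two vector fields on the isospectral manifold. -/
def bracketField (X Y : Matrix (Fin n) (Fin n) ℝ → Matrix (Fin n) (Fin n) ℝ)
    (H : Matrix (Fin n) (Fin n) ℝ) : Matrix (Fin n) (Fin n) ℝ :=
  dirDeriv Y H (X H) - dirDeriv X H (Y H)

/-- The right-hand side of the Koszul formula, which is `g(∇_X Y, Z)` at `H` for the Levi-Civita
connection `∇` of the normal metric `g`. -/
def koszul (X Y Z : Matrix (Fin n) (Fin n) ℝ → Matrix (Fin n) (Fin n) ℝ)
    (H : Matrix (Fin n) (Fin n) ℝ) : ℝ :=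
  (1 / 2 : ℝ) *
    (dirDeriv (fun A => normalMetric A (Y A) (Z A)) H (X H)
      + dirDeriv (fun A => normalMetric A (Z A) (X A)) H (Y H)
      - dirDeriv (fun A => normalMetric A (X A) (Y A)) H (Z H)
      + normalMetric H (bracketField X Y H) (Z H)
      - normalMetric H (bracketField Y Z H) (X H)
      + normalMetric H (bracketField Z X H) (Y H))

open Classical in
/-- The Levi-Civita covariant derivative `∇_X Y` at `H` for the normal metric: the tangent vector
determined by the Koszul formula. -/
def leviCivita (X Y : Matrix (Fin n) (Fin n) ℝ → Matrix (Fin n) (Fin n) ℝ)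
    (H : Matrix (Fin n) (Fin n) ℝ) : Matrix (Fin n) (Fin n) ℝ :=
  if h : ∃ W, W ∈ isoTangent H ∧
      ∀ Ω, IsSkew Ω → normalMetric H W (fundField Ω H) = koszul X Y (fundField Ω) H
  then h.choose else 0

/-- The Hessian `(∇²f)(X, Y) = X(Y f) - (∇_X Y) f` on vector fields, at the point `H`. -/
def hessianField (f : Matrix (Fin n) (Fin n) ℝ → ℝ)
    (X Y : Matrix (Fin n) (Fin n) ℝ → Matrix (Fin n) (Fin n) ℝ)
    (H : Matrix (Fin n) (Fin n) ℝ) : ℝ :=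
  dirDeriv (fun A => dirDeriv f A (Y A)) H (X H) - dirDeriv f H (leviCivita X Y H)

/-- The Riemannian Hessian of `f` at `H` on two tangent vectors. As `∇²f` is a tensor, any
extensions of the vectors to vector fields may be used; here `[H, Ω]` is extended by
`A ↦ [A, Ω]`. -/
def hessian (f : Matrix (Fin n) (Fin n) ℝ → ℝ) (H X Y : Matrix (Fin n) (Fin n) ℝ) : ℝ :=
  hessianField f (fundField (adInv H X)) (fundField (adInv H Y)) H

/-- The normal space at `H` of a submanifold `E` of the isospectral manifold, for the normal
metric. -/
def normalSpace (E : Set (Matrix (Fin n) (Fin n) ℝ)) (H : Matrix (Fin n) (Fin n) ℝ) :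
    Set (Matrix (Fin n) (Fin n) ℝ) :=
  {X | X ∈ isoTangent H ∧ ∀ Y ∈ tangentSpaceAt E H, normalMetric H X Y = 0}

/-- The form `B` is nondegenerate when restricted to `N`. -/
def NondegenerateOn {V : Type*} [Zero V] (B : V → V → ℝ) (N : Set V) : Prop :=
  (∀ X ∈ N, (∀ Y ∈ N, B X Y = 0) → X = 0) ∧ (∀ Y ∈ N, (∀ X ∈ N, B X Y = 0) → Y = 0)

/-- The diagonal potential `½ ∑ dᵢ²`. -/
def diagPotential (H : Matrix (Fin n) (Fin n) ℝ) : ℝ := (1 / 2 : ℝ) * ∑ i, (H i i) ^ 2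

/-- Conjugation `A ↦ Pᵀ A P` by the permutation matrix `P` of `σ`. -/
def permConj (σ : Equiv.Perm (Fin n)) (A : Matrix (Fin n) (Fin n) ℝ) :
    Matrix (Fin n) (Fin n) ℝ :=
  (σ.permMatrix ℝ)ᵀ * A * σ.permMatrix ℝ

end Geometry

/-- `Ψ` is a Morse-Bott function on `Sym(Λ)` with the normal metric: it is smooth, the zero set of
its gradient is a finite disjoint union of connected submanifolds, and at each point of each of
them the Hessian is nondegenerate on the normal space. -/
def IsMorseBott (Λ : Finset ℝ) (Ψ : Mat Λ → ℝ) : Prop :=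
  (∃ Ψ' : Mat Λ → ℝ, ContDiff ℝ ∞ Ψ' ∧ Set.EqOn Ψ Ψ' (isoSym Λ)) ∧
  ∃ (m : ℕ) (E : Fin m → Set (Mat Λ)),
    {H | H ∈ isoSym Λ ∧ IsGradientAt Ψ H 0} = ⋃ i, E i ∧
    Pairwise (Function.onFun Disjoint E) ∧
    ∀ i, IsConnected (E i) ∧ (∃ d, IsSubmanifold (E i) d) ∧
      ∀ H ∈ E i, NondegenerateOn (hessian Ψ H) (normalSpace (E i) H)

/-! ### Partitions and the sets `E_α` -/

/-- An ordered partition `(Λ₁, …, Λ_k)` of `Λ` into nonempty sets. -/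
structure OrderedPartition (Λ : Finset ℝ) where
  k : ℕ
  part : Fin k → Finset ℝ
  nonempty : ∀ i, (part i).Nonempty
  disjoint : Pairwise (Function.onFun Disjoint part)
  cover : Finset.univ.biUnion part = Λ

namespace OrderedPartition

variable {Λ : Finset ℝ} (α : OrderedPartition Λ)

/-- The size `n_i` of the `i`-th part. -/
abbrev size (i : Fin α.k) : ℕ := (α.part i).card

theorem sum_size : ∑ i, α.size i = Λ.card := by
  conv_rhs => rw [← α.cover]
  rw [Finset.card_biUnion]
  intro i _ j _ hij
  exact α.disjoint hij

/-- The `a`-th row of the `i`-th block is the row number `n_1 + ⋯ + n_{i-1} + a`. -/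
def blockEquiv : (Σ i : Fin α.k, Fin (α.size i)) ≃ Fin Λ.card :=
  finSigmaFinEquiv.trans (finCongr α.sum_size)

/-- Families `(B_1, …, B_k)` of square matrices of the sizes of the parts. -/
abbrev Blocks : Type := ∀ i : Fin α.k, Matrix (Fin (α.size i)) (Fin (α.size i)) ℝ

/-- The block-diagonal matrix `Diag(B_1, …, B_k)`. -/
def diag (B : α.Blocks) : Mat Λ :=
  Matrix.reindex α.blockEquiv α.blockEquiv (Matrix.blockDiagonal' B)

/-- `B_i` lies in `Sym(Λ_i)` and its diagonal entries equal `μ(Λ_i)`, for every `i`. -/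
def IsCritical (B : α.Blocks) : Prop :=
  ∀ i, B i ∈ isoSym (α.part i) ∧ ∀ a, B i a a = mean (α.part i)

/-- The critical manifold `E_α`. -/
def E : Set (Mat Λ) := {H | ∃ B : α.Blocks, α.IsCritical B ∧ α.diag B = H}

/-- The eigenvalues `λ_{i1} < ⋯ < λ_{in_i}` that form the `i`-th part. -/
def eig (i : Fin α.k) (a : Fin (α.size i)) : ℝ := (α.part i).orderEmbOfFin rfl a

/-- The vector in `ℝⁿ` whose `p`-th block is `v` and whose other blocks are zero. -/
def extend (p : Fin α.k) (v : Fin (α.size p) → ℝ) : Fin Λ.card → ℝ := fun x =>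
  (Pi.single p v : ∀ i : Fin α.k, Fin (α.size i) → ℝ)
    (α.blockEquiv.symm x).1 (α.blockEquiv.symm x).2

/-- Index set `{(p, q, i, j) | p < q}` of the off block-diagonal basis vectors. -/
abbrev OffIndex : Type :=
  Σ pq : {pq : Fin α.k × Fin α.k // pq.1 < pq.2}, Fin (α.size pq.1.1) × Fin (α.size pq.1.2)

/-- Index set `{(i, j) | 1 ≤ j ≤ n_i - 1}` of the block-diagonal basis vectors. -/
abbrev DiagIndex : Type := Σ i : Fin α.k, Fin (α.size i - 1)

/-- `N_{pq,ij}`: the symmetric matrix with `pq`-th block `(λ_{pi} - λ_{qj}) v_{pi} v_{qj}ᵀ`, with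
the transpose of this as `qp`-th block, and with all other blocks zero. -/
def offVec (v : ∀ i : Fin α.k, Fin (α.size i) → Fin (α.size i) → ℝ) (x : α.OffIndex) : Mat Λ :=
  (α.eig x.1.1.1 x.2.1 - α.eig x.1.1.2 x.2.2) •
    (vecMulVec (α.extend x.1.1.1 (v _ x.2.1)) (α.extend x.1.1.2 (v _ x.2.2)) +
      vecMulVec (α.extend x.1.1.2 (v _ x.2.2)) (α.extend x.1.1.1 (v _ x.2.1)))

/-- `N_{i,j}`: the matrix with `i`-th diagonal block `[B_i, Ω_{i,j}]` and all other blocks zero. -/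
def diagVec (B : α.Blocks)
    (Ω : ∀ i : Fin α.k, Fin (α.size i - 1) → Matrix (Fin (α.size i)) (Fin (α.size i)) ℝ)
    (y : α.DiagIndex) : Mat Λ :=
  α.diag (Pi.single y.1 ⁅B y.1, Ω y.1 y.2⁆)

/-- `v_{i1}, …, v_{in_i}` are unit eigenvectors of `B_i` for the eigenvalues
`λ_{i1}, …, λ_{in_i}`. -/
def IsUnitEigen (B : α.Blocks) (v : ∀ i : Fin α.k, Fin (α.size i) → Fin (α.size i) → ℝ) : Prop :=
  ∀ i a, B i *ᵥ v i a = α.eig i a • v i a ∧ v i a ⬝ᵥ v i a = 1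

/-- `u_{i,1}, …, u_{i,n_i-1}` is an orthonormal basis of the hyperplane `(1, …, 1)^⊥` of
`ℝ^{n_i}`, for every `i`. -/
def IsHyperplaneBasis (u : ∀ i : Fin α.k, Fin (α.size i - 1) → Fin (α.size i) → ℝ) : Prop :=
  ∀ i, (∀ j, ∑ a, u i j a = 0) ∧ ∀ j j', u i j ⬝ᵥ u i j' = if j = j' then 1 else 0

end OrderedPartition

end DiagPotential

end

open DiagPotential

/-!
A matrix `H` in `Sym(Λ)` is critical for the potential if and only if it commutes with
`D = Diag(H.diag)`. It is then block diagonal for the level sets of its diagonal, and each diagonal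
entry is the mean of the eigenvalues of its block, so the diagonal takes finitely many values on
the critical set. Strong disjointness makes the part of `Λ` that belongs to a block determined by
its mean, which identifies `E_α` with the open and closed set of the critical points whose diagonal
is that of `E_α`.

Near a critical `H` the critical set is the zero set of a smooth map `F` whose values lie in the
range of `F'(H)`; it is therefore a submanifold with tangent space `ker F'(H)`. The range is
computed from two facts: the commutant of `D` contains enough tangent vectors because
`e ↦ diag [H, [Diag(e), H]]` is surjective onto the vectors with vanishing block means, and this
holds because `e ⬝ᵥ diag [H, [Diag(e), H]]` is, up to sign, the squared norm of `[Diag(e), H]`,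
which vanishes only if `e` is constant on each block, again by strong disjointness.

At a critical point `∇²Ψ(X, [H, Ω]) = tr (X (Diag(diag [H, Ω]) - [D, Ω]))`. If `X` commutes with
`D` this is the dot product of the diagonals of `X` and `[H, Ω]`. If `u`, `v` are common
eigenvectors of `H` and `D`, with eigenvalues `λ`, `λ'` of `H` and `μ ≠ μ'` of `D`, then
`[H, u vᵀ - v uᵀ]` has zero diagonal and pairs with `X` to `-2 (μ - μ') uᵀ X v`. A normal vector
annihilated by all of these and by itself commutes with `D` and has zero diagonal; it is then also
tangent to the critical set, hence zero.
-/

namespace DiagPotential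

attribute [local instance] LieRing.ofAssociativeRing

/-! ### Clean equations -/

section CleanEquations

variable {V W : Type*} [NormedAddCommGroup V] [NormedSpace ℝ V] [NormedAddCommGroup W]
  [NormedSpace ℝ W]

/-- The equation `F = 0` cuts out `S` cleanly at `x`: it defines `S` near `x`, and `F` takes all its
values in the range of its derivative `A` at `x`. The latter replaces both the surjectivity of `A`,
which may fail in `W`, and the constancy of the rank of `F` near `x`. -/
structure IsCleanEquationAt (S : Set V) (F : V → W) (A : V →L[ℝ] W) (x : V) : Prop where
  contDiff : ContDiff ℝ ∞ F
  hasFDerivAt : HasFDerivAt F A x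
  mem_range : ∀ y, F y ∈ A.range
  eventually_mem_iff : ∀ᶠ y in 𝓝 x, y ∈ S ↔ F y = 0

variable {S T : Set V} {F : V → W} {A : V →L[ℝ] W} {x : V}

theorem IsCleanEquationAt.congr_set (h : IsCleanEquationAt S F A x)
    (hST : ∀ᶠ y in 𝓝 x, y ∈ T ↔ y ∈ S) : IsCleanEquationAt T F A x where
  __ := h
  eventually_mem_iff := by
    filter_upwards [hST, h.eventually_mem_iff] with y hTS hSF using hTS.trans hSF

theorem IsCleanEquationAt.mem_ker_of_curve (h : IsCleanEquationAt S F A x) {γ : ℝ → V} {v : V}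
    (hγ : HasDerivAt γ v 0) (h0 : γ 0 = x) (hS : ∀ᶠ t in 𝓝 0, γ t ∈ S) : v ∈ A.ker := by
  subst h0
  have hzero : F ∘ γ =ᶠ[𝓝 0] fun _ => 0 := by
    filter_upwards [hS, hγ.continuousAt.eventually h.eventually_mem_iff] with t ht hF
    exact hF.1 ht
  exact ((h.hasFDerivAt.comp_hasDerivAt 0 hγ).congr_of_eventuallyEq hzero.symm).unique
    (hasDerivAt_const _ _)

theorem locallyConnectedSpace_of_slice_charts (h : ∀ x ∈ S,
    ∃ (Φ : OpenPartialHomeomorph V V) (L : Submodule ℝ V), x ∈ Φ.source ∧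
      ∀ y ∈ Φ.source, (y ∈ S ↔ Φ y ∈ L)) : LocallyConnectedSpace S := by
  refine locallyConnectedSpace_iff_connected_subsets.2 ?_
  rintro ⟨x, hx⟩ U hU
  obtain ⟨Φ, L, hxs, hΦ⟩ := h x hx
  obtain ⟨U', hU', hUU'⟩ := (mem_nhds_subtype S ⟨x, hx⟩ U).1 hU
  have hsymm : ContinuousAt Φ.symm (Φ x) := Φ.continuousAt_symm (Φ.map_source hxs)
  have hmem : Φ.target ∩ Φ.symm ⁻¹' U' ∈ 𝓝 (Φ x) :=
    Filter.inter_mem (Φ.open_target.mem_nhds (Φ.map_source hxs))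
      (hsymm.preimage_mem_nhds (by rwa [Φ.left_inv hxs]))
  obtain ⟨ε, hε, hball⟩ := Metric.mem_nhds_iff.1 hmem
  let T : Set V := Φ.symm '' (Metric.ball (Φ x) ε ∩ L)
  have hTS : T ⊆ S := by
    rintro _ ⟨z, ⟨hz, hzL⟩, rfl⟩
    rw [hΦ _ (Φ.map_target (hball hz).1), Φ.right_inv (hball hz).1]
    exact hzL
  have hT : IsPreconnected T :=
    ((convex_ball _ _).inter L.convex).isPreconnected.image _
      (Φ.continuousOn_symm.mono fun z hz => (hball hz.1).1)
  refine ⟨Subtype.val ⁻¹' T, ?_, ?_, ?_⟩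
  · have hnear : Φ.source ∩ Φ ⁻¹' Metric.ball (Φ x) ε ∈ 𝓝 x :=
      Filter.inter_mem (Φ.open_source.mem_nhds hxs)
        ((Φ.continuousAt hxs).preimage_mem_nhds (Metric.ball_mem_nhds _ hε))
    filter_upwards [continuous_subtype_val.continuousAt.preimage_mem_nhds hnear] with y hy
    exact ⟨Φ y, ⟨hy.2, (hΦ y hy.1).1 y.2⟩, Φ.left_inv hy.1⟩
  · rwa [← Topology.IsInducing.subtypeVal.isPreconnected_image, Subtype.image_preimage_coe,
      Set.inter_eq_right.2 hTS]
  · rintro y ⟨z, ⟨hz, -⟩, hzy⟩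
    exact hUU' (by rw [Set.mem_preimage, ← hzy]; exact (hball hz).2)

theorem exists_chart_of_hasFDerivAt_id [CompleteSpace V] {φ : V → V} (hφ : ContDiff ℝ ∞ φ)
    (hφx : HasFDerivAt φ (ContinuousLinearMap.id ℝ V) x) {U : Set V} (hU : U ∈ 𝓝 x) :
    ∃ Φ : OpenPartialHomeomorph V V, ⇑Φ = φ ∧ x ∈ Φ.source ∧ Φ.source ⊆ U ∧
      ContDiffOn ℝ ∞ Φ.symm Φ.target := by
  have hφe : HasFDerivAt φ ((ContinuousLinearEquiv.refl ℝ V : V ≃L[ℝ] V) : V →L[ℝ] V) x := hφx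
  have hreg : IsOpen {y | IsUnit (fderiv ℝ φ y)} :=
    Units.isOpen.preimage (hφ.continuous_fderiv (by simp))
  let Φ := ((hφ.contDiffAt (x := x)).toOpenPartialHomeomorph φ hφe (by simp)).restrOpen
    (interior U ∩ {y | IsUnit (fderiv ℝ φ y)}) (isOpen_interior.inter hreg)
  refine ⟨Φ, rfl, ⟨ContDiffAt.mem_toOpenPartialHomeomorph_source _ _ _,
    mem_interior_iff_mem_nhds.2 hU, ?_⟩, fun y hy => interior_subset hy.2.1, fun z hz => ?_⟩
  · rw [Set.mem_ofPred_eq, hφx.fderiv]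
    exact isUnit_one
  · obtain ⟨u, hu⟩ : IsUnit (fderiv ℝ φ (Φ.symm z)) := (Φ.map_target hz).2.2
    have hder : HasFDerivAt φ (u : V →L[ℝ] V) (Φ.symm z) := by
      rw [hu]
      exact (hφ.differentiable (by simp) _).hasFDerivAt
    exact (Φ.contDiffAt_symm (f₀' := ContinuousLinearEquiv.unitsEquiv ℝ V u) hz hder
      hφ.contDiffAt).contDiffWithinAt

variable [FiniteDimensional ℝ V] [FiniteDimensional ℝ W]

namespace IsCleanEquationAt

-- `φ y = y + R (F y - A y)` for a right inverse `R` of `A` on its range.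
theorem exists_straightening (h : IsCleanEquationAt S F A x) :
    ∃ φ : V → V, ContDiff ℝ ∞ φ ∧ HasFDerivAt φ (ContinuousLinearMap.id ℝ V) x ∧
      ∀ y, A (φ y) = F y := by
  obtain ⟨g, hg⟩ := (A : V →ₗ[ℝ] W).rangeRestrict.exists_rightInverse_of_surjective
    (LinearMap.range_rangeRestrict _)
  obtain ⟨R', hR'⟩ := LinearMap.exists_extend g
  have hAR : ∀ w ∈ A.range, A (R' w) = w := fun w hw => by
    rw [show R' w = g ⟨w, hw⟩ from LinearMap.congr_fun hR' ⟨w, hw⟩]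
    exact congrArg Subtype.val (LinearMap.congr_fun hg ⟨w, hw⟩)
  let R : W →L[ℝ] V := LinearMap.toContinuousLinearMap R'
  refine ⟨fun y => y + R (F y - A y),
    contDiff_id.add (R.contDiff.comp (h.contDiff.sub A.contDiff)), ?_, fun y => ?_⟩
  · exact ((hasFDerivAt_id x).add (R.hasFDerivAt.comp x
      (h.hasFDerivAt.sub A.hasFDerivAt))).congr_fderiv (by simp)
  · have hR : A (R (F y - A y)) = F y - A y :=
      hAR _ (Submodule.sub_mem _ (h.mem_range y) (LinearMap.mem_range_self _ y))
    rw [map_add, hR, add_sub_cancel]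

theorem exists_slice_chart (h : IsCleanEquationAt S F A x) :
    ∃ Φ : OpenPartialHomeomorph V V, x ∈ Φ.source ∧ ContDiffOn ℝ ∞ Φ Φ.source ∧
      ContDiffOn ℝ ∞ Φ.symm Φ.target ∧ (∀ y ∈ Φ.source, (y ∈ S ↔ Φ y ∈ A.ker)) ∧
      HasFDerivAt Φ (ContinuousLinearMap.id ℝ V) x := by
  obtain ⟨φ, hφ, hφx, hAφ⟩ := h.exists_straightening
  obtain ⟨Φ, rfl, hx, hU, hsymm⟩ := exists_chart_of_hasFDerivAt_id hφ hφx h.eventually_mem_iff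
  refine ⟨Φ, hx, hφ.contDiffOn, hsymm, fun y hy => ?_, hφx⟩
  rw [LinearMap.mem_ker, ContinuousLinearMap.coe_coe, hAφ]
  exact hU hy

theorem exists_curve_of_mem_ker (h : IsCleanEquationAt S F A x) (hx : x ∈ S) {v : V}
    (hv : v ∈ A.ker) : ∃ γ : ℝ → V, ContDiffAt ℝ ∞ γ 0 ∧ γ 0 = x ∧
      (∀ᶠ t in 𝓝 (0 : ℝ), γ t ∈ S) ∧ deriv γ 0 = v := by
  obtain ⟨Φ, hxs, -, hsymm, hΦ, hd⟩ := h.exists_slice_chart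
  have hline : Φ x + (0 : ℝ) • v = Φ x := by simp
  have htarget : Φ.target ∈ 𝓝 (Φ x + (0 : ℝ) • v) := by
    rw [hline]
    exact Φ.open_target.mem_nhds (Φ.map_source hxs)
  refine ⟨fun t => Φ.symm (Φ x + t • v), ?_, by simp [Φ.left_inv hxs], ?_, ?_⟩
  · exact (hsymm.contDiffAt htarget).comp (0 : ℝ) (f := fun t : ℝ => Φ x + t • v) (by fun_prop)
  · have hc : ContinuousAt (fun t : ℝ => Φ x + t • v) 0 := by fun_prop
    filter_upwards [hc.eventually htarget] with t ht
    rw [hΦ _ (Φ.map_target ht), Φ.right_inv ht]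
    exact Submodule.add_mem _ ((hΦ x hxs).1 hx) (Submodule.smul_mem _ _ hv)
  · have hsymm' : HasFDerivAt Φ.symm (ContinuousLinearMap.id ℝ V) (Φ x + (0 : ℝ) • v) := by
      rw [hline]
      exact Φ.hasFDerivAt_symm (f' := ContinuousLinearEquiv.refl ℝ V) (Φ.map_source hxs)
        (by rw [Φ.left_inv hxs]; exact hd)
    have hline' : HasDerivAt (fun t : ℝ => Φ x + t • v) v 0 := by
      simpa using ((hasDerivAt_id (0 : ℝ)).smul_const v).const_add (Φ x)
    exact (hsymm'.comp_hasDerivAt 0 hline').deriv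

theorem tangentSpaceAt_eq_ker (h : IsCleanEquationAt S F A x) (hx : x ∈ S) :
    tangentSpaceAt S x = A.ker := by
  apply le_antisymm
  · refine Submodule.span_le.2 ?_
    rintro _ ⟨γ, hγ, h0, hS, rfl⟩
    exact h.mem_ker_of_curve (hγ.differentiableAt (by simp)).hasDerivAt h0 hS
  · exact fun v hv => Submodule.subset_span (h.exists_curve_of_mem_ker hx hv)

end IsCleanEquationAt

theorem IsSubmanifold.of_isCleanEquationAt {d : ℕ}
    (h : ∀ x ∈ S, ∃ (F : V → W) (A : V →L[ℝ] W), IsCleanEquationAt S F A x ∧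
      Module.finrank ℝ A.ker = d) : IsSubmanifold S d := fun x hx => by
  obtain ⟨F, A, hFA, hd⟩ := h x hx
  obtain ⟨Φ, hxs, hΦ, hsymm, hΦS, -⟩ := hFA.exists_slice_chart
  exact ⟨Φ, A.ker, hxs, hΦ, hsymm, hd, hΦS⟩

end CleanEquations

/-! ### Matrices and their block structure -/

section Matrices

variable {m R : Type*} [Fintype m] [CommRing R]

theorem trace_lie_mul (A B C : Matrix m m R) : (⁅A, B⁆ * C).trace = (A * ⁅B, C⁆).trace := by
  rw [Ring.lie_def, Ring.lie_def, Matrix.sub_mul, Matrix.mul_sub, trace_sub, trace_sub,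
    Matrix.mul_assoc, Matrix.trace_mul_cycle B A C, Matrix.trace_mul_cycle C B A, Matrix.mul_assoc]

theorem transpose_mul_mul_apply_comm {ι : Type*} {A : Matrix m m R} (hA : Aᵀ = A)
    (Q : Matrix m ι R) (i j : ι) : (Qᵀ * A * Q) i j = (Qᵀ * A * Q) j i := by
  rw [← transpose_apply (Qᵀ * A * Q), Matrix.transpose_mul, Matrix.transpose_mul,
    transpose_transpose, hA, Matrix.mul_assoc]

variable [DecidableEq m]

theorem trace_diagonal_mul (d : m → R) (A : Matrix m m R) :
    (diagonal d * A).trace = d ⬝ᵥ A.diag := by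
  simp [Matrix.trace, diagonal_mul, dotProduct]

theorem diagonal_lie_apply (d : m → R) (A : Matrix m m R) (i j : m) :
    ⁅diagonal d, A⁆ i j = (d i - d j) * A i j := by
  rw [Ring.lie_def, Matrix.sub_apply, diagonal_mul, mul_diagonal]
  ring

theorem diagonal_lie_eq_zero_iff [NoZeroDivisors R] {d : m → R} {A : Matrix m m R} :
    ⁅diagonal d, A⁆ = 0 ↔ ∀ i j, d i ≠ d j → A i j = 0 := by
  simp_rw [← Matrix.ext_iff, diagonal_lie_apply, Matrix.zero_apply, mul_eq_zero, sub_eq_zero,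
    or_iff_not_imp_left]

theorem dotProduct_diag_lie (d : m → R) (A B : Matrix m m R) :
    d ⬝ᵥ ⁅A, B⁆.diag = (⁅diagonal d, A⁆ * B).trace := by
  rw [trace_lie_mul, trace_diagonal_mul]

end Matrices

section Skew

variable {n : ℕ} {A B Ω Ω₁ Ω₂ : Matrix (Fin n) (Fin n) ℝ}

theorem isSkew_iff_mem_so : IsSkew Ω ↔ Ω ∈ LieAlgebra.Orthogonal.so (Fin n) ℝ :=
  (LieAlgebra.Orthogonal.mem_so _ _ _).symm

namespace IsSkew

theorem lie (h₁ : IsSkew Ω₁) (h₂ : IsSkew Ω₂) : IsSkew ⁅Ω₁, Ω₂⁆ :=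
  isSkew_iff_mem_so.2 (LieSubalgebra.lie_mem _ (isSkew_iff_mem_so.1 h₁) (isSkew_iff_mem_so.1 h₂))

theorem smul (h : IsSkew Ω) (c : ℝ) : IsSkew (c • Ω) :=
  isSkew_iff_mem_so.2 (Submodule.smul_mem _ c (isSkew_iff_mem_so.1 h))

theorem sub (h₁ : IsSkew Ω₁) (h₂ : IsSkew Ω₂) : IsSkew (Ω₁ - Ω₂) :=
  isSkew_iff_mem_so.2 (Submodule.sub_mem _ (isSkew_iff_mem_so.1 h₁) (isSkew_iff_mem_so.1 h₂))

theorem transpose_lie (h : IsSkew Ω) (hA : Aᵀ = A) : ⁅A, Ω⁆ᵀ = ⁅A, Ω⁆ := by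
  rw [Matrix.lie_transpose, h, hA, neg_lie, lie_skew]

theorem eq_zero_of_trace_mul_self (h : IsSkew Ω) (h0 : (Ω * Ω).trace = 0) : Ω = 0 := by
  apply Matrix.trace_mul_conjTranspose_self_eq_zero_iff.1
  rw [conjTranspose_eq_transpose_of_trivial, h, Matrix.mul_neg, trace_neg, h0, neg_zero]

end IsSkew

theorem isSkew_lie_of_symm (hA : Aᵀ = A) (hB : Bᵀ = B) : IsSkew ⁅A, B⁆ := by
  rw [IsSkew, Matrix.lie_transpose, hA, hB, lie_skew]

end Skew

section Levels

variable {m κ K : Type*} [Fintype m] [DecidableEq κ] [Field K]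

/-- Averaging of vectors over the level sets of `f`. -/
def levelMean (f : m → κ) : (m → K) →ₗ[K] m → K where
  toFun u i := (∑ j with f j = f i, u j) / (Finset.univ.filter fun j => f j = f i).card
  map_add' u v := by
    ext i
    simp only [Pi.add_apply, Finset.sum_add_distrib, add_div]
  map_smul' c u := by
    ext i
    simp only [Pi.smul_apply, smul_eq_mul, ← Finset.mul_sum, mul_div_assoc, RingHom.id_apply]

theorem levelMean_apply (f : m → κ) (u : m → K) (i : m) :
    levelMean f u i = (∑ j with f j = f i, u j) / (Finset.univ.filter fun j => f j = f i).card :=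
  rfl

variable [CharZero K]

theorem card_level_ne_zero (f : m → κ) (i : m) :
    ((Finset.univ.filter fun j => f j = f i).card : K) ≠ 0 :=
  Nat.cast_ne_zero.2 (Finset.card_pos.2 ⟨i, by simp⟩).ne'

theorem levelMean_eq_self_iff {f : m → κ} {u : m → K} :
    levelMean f u = u ↔ ∀ i j, f i = f j → u i = u j := by
  refine ⟨fun h i j hij => ?_, fun h => funext fun i => ?_⟩
  · rw [← h, levelMean_apply, levelMean_apply, hij]
  · rw [levelMean_apply, Finset.sum_congr rfl fun j hj => h j i (Finset.mem_filter.1 hj).2,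
      Finset.sum_const, nsmul_eq_mul, mul_div_cancel_left₀ _ (card_level_ne_zero f i)]

theorem isIdempotentElem_levelMean (f : m → κ) :
    IsIdempotentElem (levelMean f : (m → K) →ₗ[K] m → K) :=
  LinearMap.ext fun u => levelMean_eq_self_iff.2 fun i j hij => by
    rw [levelMean_apply, levelMean_apply, hij]

theorem mem_ker_levelMean {f : m → κ} {u : m → K} :
    u ∈ LinearMap.ker (levelMean f) ↔ ∀ i, ∑ j with f j = f i, u j = 0 := by
  rw [LinearMap.mem_ker, funext_iff]
  refine forall_congr' fun i => ?_
  rw [levelMean_apply, Pi.zero_apply, div_eq_zero_iff, or_iff_left (card_level_ne_zero f i)]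

end Levels

section BlockSymm

variable {m κ K : Type*} [DecidableEq κ] [Field K]

/-- The projection of square matrices onto the symmetric matrices that are block diagonal for the
partition of the indices into the level sets of `f`. -/
def blockSymm (f : m → κ) : Matrix m m K →ₗ[K] Matrix m m K where
  toFun X := Matrix.of fun i j => if f i = f j then (X i j + X j i) / 2 else 0
  map_add' X Y := by
    ext i j
    simp only [of_apply, Matrix.add_apply]
    split_ifs <;> ring
  map_smul' c X := by
    ext i j
    simp only [of_apply, Matrix.smul_apply, smul_eq_mul, RingHom.id_apply]
    split_ifs <;> ring

theorem blockSymm_apply (f : m → κ) (X : Matrix m m K) (i j : m) :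
    blockSymm f X i j = if f i = f j then (X i j + X j i) / 2 else 0 :=
  rfl

variable [CharZero K]

theorem blockSymm_eq_self_iff {f : m → κ} {X : Matrix m m K} :
    blockSymm f X = X ↔ Xᵀ = X ∧ ∀ i j, f i ≠ f j → X i j = 0 := by
  refine ⟨fun h => ⟨?_, fun i j hij => ?_⟩, fun ⟨hsymm, hblock⟩ => ?_⟩
  · ext i j
    rw [← h]
    simp only [transpose_apply, blockSymm_apply, eq_comm (a := f j), add_comm (X j i)]
  · rw [← h, blockSymm_apply, if_neg hij]
  · ext i j
    rw [blockSymm_apply]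
    split_ifs with hij
    · rw [← transpose_apply X i j, hsymm, add_self_div_two]
    · exact (hblock i j hij).symm

theorem isIdempotentElem_blockSymm (f : m → κ) :
    IsIdempotentElem (blockSymm f : Matrix m m K →ₗ[K] Matrix m m K) :=
  LinearMap.ext fun X => blockSymm_eq_self_iff.2
    ⟨by ext i j; simp only [transpose_apply, blockSymm_apply, eq_comm (a := f j), add_comm (X j i)],
      fun i j hij => by rw [blockSymm_apply, if_neg hij]⟩

end BlockSymm

section Spectrum

variable {K : Type*} [Field K] {Λ : Finset K} {p q : K[X]}

theorem roots_le_of_dvd_prod_X_sub_C (h : p ∣ ∏ l ∈ Λ, (X - C l)) : p.roots ≤ Λ.val := by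
  rw [← roots_prod_X_sub_C Λ]
  exact roots.le_of_dvd (monic_prod_X_sub_C _ _).ne_zero h

variable [DecidableEq K]

theorem eq_prod_roots_of_dvd_prod_X_sub_C (hp : p.Monic) (h : p ∣ ∏ l ∈ Λ, (X - C l)) :
    p = ∏ l ∈ p.roots.toFinset, (X - C l) := by
  have hsplits : p.Splits := (Splits.prod fun l _ => Splits.X_sub_C l).of_dvd
    (monic_prod_X_sub_C (fun l => l) Λ).ne_zero h
  have hnodup : p.roots.Nodup := Multiset.nodup_of_le (roots_le_of_dvd_prod_X_sub_C h) Λ.nodup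
  conv_lhs => rw [hsplits.eq_prod_roots_of_monic hp]
  rw [Finset.prod, Multiset.toFinset_val, hnodup.dedup]

theorem disjoint_roots_of_mul_dvd_prod_X_sub_C (h : p * q ∣ ∏ l ∈ Λ, (X - C l)) :
    Disjoint p.roots.toFinset q.roots.toFinset := by
  have hnodup := Multiset.nodup_of_le (roots_le_of_dvd_prod_X_sub_C h) Λ.nodup
  rw [roots_mul (ne_zero_of_dvd_ne_zero (monic_prod_X_sub_C _ _).ne_zero h),
    Multiset.nodup_add] at hnodup
  exact Multiset.disjoint_toFinset.2 hnodup.2.2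

end Spectrum

section BlockSpectrum

variable {m κ : Type*} [Fintype m] [DecidableEq m] [LinearOrder κ] {Λ : Finset ℝ}
  {H : Matrix m m ℝ} {f : m → κ}

/-- The eigenvalues of the diagonal block of `H` on the level set `f = c`. -/
noncomputable def blockSpectrum (H : Matrix m m ℝ) (f : m → κ) (c : κ) : Finset ℝ :=
  (H.toSquareBlock f c).charpoly.roots.toFinset

variable (hΛ : H.charpoly = ∏ l ∈ Λ, (X - C l)) (hf : ∀ i j, f i ≠ f j → H i j = 0)
include hΛ hf

theorem prod_charpoly_toSquareBlock_dvd (s : Finset κ) (hs : s ⊆ Finset.univ.image f) :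
    ∏ c ∈ s, (H.toSquareBlock f c).charpoly ∣ ∏ l ∈ Λ, (X - C l) := by
  have hblock : H.BlockTriangular f := fun i j hij => hf i j hij.ne'
  rw [← hΛ, hblock.charpoly]
  exact Finset.prod_dvd_prod_of_subset _ _ _ hs

theorem charpoly_toSquareBlock_dvd (i : m) :
    (H.toSquareBlock f (f i)).charpoly ∣ ∏ l ∈ Λ, (X - C l) := by
  simpa only [Finset.prod_singleton] using
    prod_charpoly_toSquareBlock_dvd hΛ hf {f i} (by simp)

theorem blockSpectrum_subset (i : m) : blockSpectrum H f (f i) ⊆ Λ := fun _ hx =>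
  Multiset.mem_of_le (roots_le_of_dvd_prod_X_sub_C (charpoly_toSquareBlock_dvd hΛ hf i))
    (Multiset.mem_toFinset.1 hx)

theorem charpoly_toSquareBlock (i : m) :
    (H.toSquareBlock f (f i)).charpoly = ∏ l ∈ blockSpectrum H f (f i), (X - C l) :=
  eq_prod_roots_of_dvd_prod_X_sub_C (Matrix.charpoly_monic _) (charpoly_toSquareBlock_dvd hΛ hf i)

theorem card_blockSpectrum (i : m) :
    (blockSpectrum H f (f i)).card = (Finset.univ.filter fun j => f j = f i).card := by
  have hdeg := congrArg natDegree (charpoly_toSquareBlock hΛ hf i)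
  rw [Matrix.charpoly_natDegree_eq_dim, natDegree_finsetProd_X_sub_C_eq_card] at hdeg
  rw [← hdeg, Fintype.card_subtype]

theorem blockSpectrum_nonempty (i : m) : (blockSpectrum H f (f i)).Nonempty := by
  rw [← Finset.card_pos, card_blockSpectrum hΛ hf, Finset.card_pos]
  exact ⟨i, by simp⟩

theorem mean_blockSpectrum (i : m) :
    mean (blockSpectrum H f (f i)) = levelMean f H.diag i := by
  have htrace := (H.toSquareBlock f (f i)).trace_eq_neg_charpoly_nextCoeff
  rw [charpoly_toSquareBlock hΛ hf, prod_X_sub_C_nextCoeff, neg_neg] at htrace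
  rw [mean, levelMean_apply, card_blockSpectrum hΛ hf, ← htrace, Matrix.trace,
    Finset.sum_subtype (p := fun j => f j = f i) _ (by simp)]
  rfl

theorem disjoint_blockSpectrum {i j : m} (hij : f i ≠ f j) :
    Disjoint (blockSpectrum H f (f i)) (blockSpectrum H f (f j)) := by
  refine disjoint_roots_of_mul_dvd_prod_X_sub_C (Λ := Λ) ?_
  rw [← Finset.prod_pair (f := fun c => (H.toSquareBlock f c).charpoly) hij]
  exact prod_charpoly_toSquareBlock_dvd hΛ hf _ (by simp [Finset.insert_subset_iff])

theorem levelMean_diag_mem_means (i : m) :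
    levelMean f H.diag i ∈ Λ.powerset.image mean :=
  Finset.mem_image.2 ⟨_, Finset.mem_powerset.2 (blockSpectrum_subset hΛ hf i),
    mean_blockSpectrum hΛ hf i⟩

theorem StronglyDisjoint.eq_of_levelMean_diag_eq (hsd : StronglyDisjoint Λ) {i j : m}
    (hij : levelMean f H.diag i = levelMean f H.diag j) : f i = f j := by
  by_contra hne
  refine hsd _ _ (blockSpectrum_subset hΛ hf i) (blockSpectrum_subset hΛ hf j)
    (blockSpectrum_nonempty hΛ hf i) (blockSpectrum_nonempty hΛ hf j)
    (disjoint_blockSpectrum hΛ hf hne) ?_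
  rw [mean_blockSpectrum hΛ hf, mean_blockSpectrum hΛ hf, hij]

end BlockSpectrum

section Biorthogonal

variable {κ K V : Type*} [Field K] [AddCommGroup V] [Module K V] {s : κ → V}
  {φ : κ → V →ₗ[K] K} (hne : ∀ k k', k ≠ k' → φ k (s k') = 0) (hself : ∀ k, φ k (s k) ≠ 0)
include hne hself

theorem linearIndependent_of_biorthogonal : LinearIndependent K s := by
  classical
  refine linearIndependent_iff'.2 fun t c hc k hk => ?_
  have hφ := congrArg (φ k) hc
  rw [map_sum, Finset.sum_eq_single_of_mem k hk fun k' _ hk' => by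
    rw [map_smul, hne k k' hk'.symm, smul_zero], map_smul, map_zero] at hφ
  exact (mul_eq_zero.1 hφ).resolve_right (hself k)

theorem span_range_eq_of_biorthogonal [Finite κ] {N : Submodule K V} (hs : ∀ k, s k ∈ N)
    (hN : ∀ x ∈ N, (∀ k, φ k x = 0) → x = 0) : Submodule.span K (Set.range s) = N := by
  have := Fintype.ofFinite κ
  refine le_antisymm (Submodule.span_le.2 (Set.range_subset_iff.2 hs)) fun x hx => ?_
  let y : V := ∑ k, (φ k x / φ k (s k)) • s k
  have hφ : ∀ k, φ k y = φ k x := fun k => by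
    rw [map_sum, Finset.sum_eq_single k (fun k' _ hk' => by
      rw [map_smul, hne k k' hk'.symm, smul_zero]) (by simp), map_smul, smul_eq_mul,
      div_mul_cancel₀ _ (hself k)]
  have hxy : x - y = 0 := hN _ (N.sub_mem hx (Submodule.sum_mem _ fun k _ =>
    N.smul_mem _ (hs k))) fun k => by rw [map_sub, hφ, sub_self]
  rw [sub_eq_zero.1 hxy]
  exact Submodule.sum_mem _ fun k _ =>
    Submodule.smul_mem _ _ (Submodule.subset_span ⟨k, rfl⟩)

end Biorthogonal

/-! ### Eigenframes and the orbit of the orthogonal group -/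

section Eigenframe

theorem mul_eq_mul_diagonal_iff {m ι R : Type*} [Fintype m] [Fintype ι] [DecidableEq ι]
    [CommRing R] {A : Matrix m m R} {Q : Matrix m ι R} {a : ι → R} :
    A * Q = Q * diagonal a ↔ ∀ i, A *ᵥ Q.col i = a i • Q.col i := by
  rw [← Matrix.ext_iff, forall_comm]
  refine forall_congr' fun i => funext_iff.symm.trans ?_
  simp only [mul_diagonal, mul_comm _ (a i)]
  rfl

variable {m ι K : Type*} [Fintype m] [DecidableEq m] [Fintype ι] [DecidableEq ι] [Field K]

/-- The columns of `Q` are an orthonormal basis of eigenvectors of `H`, with distinct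
eigenvalues `l`. -/
structure IsEigenframe (H : Matrix m m K) (Q : Matrix m ι K) (l : ι → K) : Prop where
  transpose_mul_self : Qᵀ * Q = 1
  mul_transpose_self : Q * Qᵀ = 1
  mul_eq : H * Q = Q * diagonal l
  injective : Function.Injective l

namespace IsEigenframe

variable {H A B X : Matrix m m K} {Q : Matrix m ι K} {a l : ι → K}

theorem conj_coord (h : IsEigenframe H Q l) (A : Matrix m m K) : Q * (Qᵀ * A * Q) * Qᵀ = A := by
  rw [Matrix.mul_assoc Qᵀ, ← Matrix.mul_assoc Q, h.mul_transpose_self, Matrix.one_mul,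
    Matrix.mul_assoc, h.mul_transpose_self, Matrix.mul_one]

theorem coord_conj (h : IsEigenframe H Q l) (N : Matrix ι ι K) : Qᵀ * (Q * N * Qᵀ) * Q = N := by
  rw [Matrix.mul_assoc, Matrix.mul_assoc, h.transpose_mul_self, Matrix.mul_one, ← Matrix.mul_assoc,
    h.transpose_mul_self, Matrix.one_mul]

theorem ext_coord (h : IsEigenframe H Q l) (hAB : ∀ i j, (Qᵀ * A * Q) i j = (Qᵀ * B * Q) i j) :
    A = B := by
  rw [← h.conj_coord A, Matrix.ext hAB, h.conj_coord]

theorem eq_conj (h : IsEigenframe H Q l) (hA : A * Q = Q * diagonal a) :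
    A = Q * diagonal a * Qᵀ := by
  rw [← hA, Matrix.mul_assoc, h.mul_transpose_self, Matrix.mul_one]

theorem transpose_eq_self (h : IsEigenframe H Q l) : Hᵀ = H := by
  rw [h.eq_conj h.mul_eq, Matrix.transpose_mul, Matrix.transpose_mul, transpose_transpose,
    diagonal_transpose, Matrix.mul_assoc]

theorem transpose_mul (h : IsEigenframe H Q l) (hA : A * Q = Q * diagonal a) :
    Qᵀ * A = diagonal a * Qᵀ := by
  rw [h.eq_conj hA, ← Matrix.mul_assoc, ← Matrix.mul_assoc, h.transpose_mul_self, Matrix.one_mul]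

theorem coord_lie (h : IsEigenframe H Q l) (hA : A * Q = Q * diagonal a) (X : Matrix m m K)
    (i j : ι) : (Qᵀ * ⁅A, X⁆ * Q) i j = (a i - a j) * (Qᵀ * X * Q) i j := by
  have hconj : Qᵀ * ⁅A, X⁆ * Q = ⁅diagonal a, Qᵀ * X * Q⁆ := by
    rw [Ring.lie_def, Ring.lie_def, Matrix.mul_sub, Matrix.sub_mul, ← Matrix.mul_assoc,
      h.transpose_mul hA, Matrix.mul_assoc (Qᵀ * X), ← hA]
    simp only [Matrix.mul_assoc]
  rw [hconj, diagonal_lie_apply]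

theorem coord_eq_zero_of_lie_eq_zero (h : IsEigenframe H Q l) (hX : ⁅H, X⁆ = 0) {i j : ι}
    (hij : i ≠ j) : (Qᵀ * X * Q) i j = 0 := by
  have hcoord := h.coord_lie h.mul_eq X i j
  rw [hX, Matrix.mul_zero, Matrix.zero_mul, Matrix.zero_apply, zero_eq_mul, sub_eq_zero] at hcoord
  exact hcoord.resolve_left (h.injective.ne hij)

theorem exists_mul_eq_of_lie_eq_zero (h : IsEigenframe H Q l) (hA : ⁅H, A⁆ = 0) :
    ∃ a : ι → K, A * Q = Q * diagonal a := by
  have hdiag : Qᵀ * A * Q = diagonal (Qᵀ * A * Q).diag := by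
    ext i j
    obtain rfl | hij := eq_or_ne i j
    · rw [diagonal_apply_eq, diag_apply]
    · rw [diagonal_apply_ne _ hij, h.coord_eq_zero_of_lie_eq_zero hA hij]
  refine ⟨(Qᵀ * A * Q).diag, ?_⟩
  rw [← hdiag, ← Matrix.mul_assoc, ← Matrix.mul_assoc, h.mul_transpose_self, Matrix.one_mul]

theorem of_unit_eigenvectors (hH : Hᵀ = H) (hl : Function.Injective l)
    (hQ : H * Q = Q * diagonal l) (hunit : ∀ i, Q.col i ⬝ᵥ Q.col i = 1)
    (hcard : Fintype.card ι = Fintype.card m) : IsEigenframe H Q l := by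
  rw [mul_eq_mul_diagonal_iff] at hQ
  have horth : Qᵀ * Q = 1 := by
    ext i j
    change Q.col i ⬝ᵥ Q.col j = _
    obtain rfl | hij := eq_or_ne i j
    · rw [hunit, one_apply_eq]
    · have hself : Q.col i ⬝ᵥ (H *ᵥ Q.col j) = (H *ᵥ Q.col i) ⬝ᵥ Q.col j := by
        rw [Matrix.dotProduct_mulVec, ← Matrix.mulVec_transpose, hH]
      rw [hQ, hQ, dotProduct_smul, smul_dotProduct, smul_eq_mul, smul_eq_mul,
        mul_eq_mul_right_iff] at hself
      rw [one_apply_ne hij, hself.resolve_left (hl.ne hij.symm)]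
  exact ⟨horth, (Matrix.mul_eq_one_comm_of_card_eq _ _ _ hcard).1 horth,
    mul_eq_mul_diagonal_iff.2 hQ, hl⟩

end IsEigenframe

variable {n : ℕ} {H X Ω : Matrix (Fin n) (Fin n) ℝ} {Q : Matrix (Fin n) ι ℝ} {l : ι → ℝ}

theorem IsEigenframe.eq_zero_of_lie_eq_zero (h : IsEigenframe H Q l) (hΩ : IsSkew Ω)
    (hlie : ⁅H, Ω⁆ = 0) : Ω = 0 := by
  refine h.ext_coord fun i j => ?_
  rw [Matrix.mul_zero, Matrix.zero_mul, Matrix.zero_apply]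
  obtain rfl | hij := eq_or_ne i j
  · have hskew : (Qᵀ * Ω * Q)ᵀ = -(Qᵀ * Ω * Q) := by
      rw [Matrix.transpose_mul, Matrix.transpose_mul, transpose_transpose, hΩ, ← Matrix.mul_assoc,
        Matrix.mul_neg, Matrix.neg_mul]
    have hii := congrFun (congrFun hskew i) i
    rw [transpose_apply, Matrix.neg_apply] at hii
    exact self_eq_neg.1 hii
  · exact h.coord_eq_zero_of_lie_eq_zero hlie hij

theorem IsEigenframe.mem_isoTangent (h : IsEigenframe H Q l) (hX : Xᵀ = X)
    (hdiag : ∀ i, (Qᵀ * X * Q) i i = 0) : X ∈ isoTangent H := by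
  let N : Matrix ι ι ℝ := Matrix.of fun i j => (Qᵀ * X * Q) i j / (l i - l j)
  have hN : Nᵀ = -N := by
    ext i j
    simp only [N, transpose_apply, of_apply, Matrix.neg_apply]
    rw [transpose_mul_mul_apply_comm hX Q j i, ← div_neg, neg_sub]
  refine ⟨Q * N * Qᵀ, ?_, h.ext_coord fun i j => ?_⟩
  · rw [IsSkew, Matrix.transpose_mul, Matrix.transpose_mul, transpose_transpose, hN,
      ← Matrix.mul_assoc, Matrix.mul_neg, Matrix.neg_mul]
  · rw [h.coord_lie h.mul_eq, h.coord_conj]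
    obtain rfl | hij := eq_or_ne i j
    · rw [hdiag, sub_self, zero_mul]
    · exact mul_div_cancel₀ _ (sub_ne_zero.2 (h.injective.ne hij))

end Eigenframe

section Isospectral

variable {Λ : Finset ℝ} {H : Mat Λ}

theorem prod_X_sub_C_eq_prod_orderEmbOfFin (Λ : Finset ℝ) :
    ∏ l ∈ Λ, (X - C l) = ∏ i : Fin Λ.card, (X - C (Λ.orderEmbOfFin rfl i)) := by
  simpa using Finset.prod_map Finset.univ (Λ.orderEmbOfFin rfl).toEmbedding
    fun l => (X - C l : ℝ[X])

theorem mem_isoSym_iff_det : H ∈ isoSym Λ ↔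
    Hᵀ = H ∧ ∀ i, (scalar (Fin Λ.card) (Λ.orderEmbOfFin rfl i) - H).det = 0 := by
  simp only [isoSym, Set.mem_ofPred_eq, ← Matrix.eval_charpoly]
  refine and_congr_right fun _ => ⟨fun h i => ?_, fun h => ?_⟩
  · rw [h, prod_X_sub_C_eq_prod_orderEmbOfFin, eval_prod]
    exact Finset.prod_eq_zero (Finset.mem_univ i) (by simp)
  · have hdvd : ∏ l ∈ Λ, (X - C l) ∣ H.charpoly := by
      refine Finset.prod_dvd_of_coprime
        (fun a _ b _ hab => pairwise_coprime_X_sub_C Function.injective_id hab) fun a ha => ?_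
      obtain ⟨i, rfl⟩ : a ∈ Set.range (Λ.orderEmbOfFin rfl) := by
        rwa [Finset.range_orderEmbOfFin, Finset.mem_coe]
      exact dvd_iff_isRoot.2 (h i)
    refine Polynomial.eq_of_monic_of_dvd_of_natDegree_le (monic_prod_X_sub_C _ _)
      H.charpoly_monic hdvd ?_
    rw [H.charpoly_natDegree_eq_dim, natDegree_finsetProd_X_sub_C_eq_card, Fintype.card_fin]

theorem exists_unit_eigenvector {m : Type*} [Fintype m] [DecidableEq m] {A : Matrix m m ℝ} {c : ℝ}
    (h : (scalar m c - A).det = 0) : ∃ w : m → ℝ, A *ᵥ w = c • w ∧ w ⬝ᵥ w = 1 := by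
  obtain ⟨v, hv0, hv⟩ := Matrix.exists_mulVec_eq_zero_iff.2 h
  rw [Matrix.sub_mulVec, sub_eq_zero] at hv
  have hpos : 0 < v ⬝ᵥ v := (Finset.sum_nonneg fun i _ => mul_self_nonneg _).lt_of_ne
    fun h0 => hv0 (dotProduct_self_eq_zero.1 h0.symm)
  refine ⟨(√(v ⬝ᵥ v))⁻¹ • v, ?_, ?_⟩
  · rw [mulVec_smul, ← hv, smul_comm, scalar_apply, diagonal_const_mulVec]
  · rw [smul_dotProduct, dotProduct_smul, smul_smul, smul_eq_mul, ← mul_inv,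
      Real.mul_self_sqrt hpos.le, inv_mul_cancel₀ hpos.ne']

theorem exists_isEigenframe (hH : H ∈ isoSym Λ) :
    ∃ Q : Mat Λ, IsEigenframe H Q (Λ.orderEmbOfFin rfl) := by
  choose w hw hunit using fun i => exists_unit_eigenvector ((mem_isoSym_iff_det.1 hH).2 i)
  exact ⟨(Matrix.of w)ᵀ, .of_unit_eigenvectors hH.1 (Λ.orderEmbOfFin rfl).injective
    (mul_eq_mul_diagonal_iff.2 hw) hunit rfl⟩

end Isospectral

section Orbit

variable {n : ℕ} {Λ : Finset ℝ} {H : Mat Λ} {Ω Ω₁ Ω₂ Ω₃ : Mat Λ}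

theorem exp_neg_mul_exp (Ω : Matrix (Fin n) (Fin n) ℝ) :
    NormedSpace.exp (-Ω) * NormedSpace.exp Ω = 1 := by
  rw [← Matrix.exp_add_of_commute _ _ (Commute.refl Ω).neg_left, neg_add_cancel,
    NormedSpace.exp_zero]

theorem orbitCurve_zero (H Ω : Matrix (Fin n) (Fin n) ℝ) : orbitCurve H Ω 0 = H := by
  simp [orbitCurve]

theorem hasDerivAt_orbitCurve (H Ω : Matrix (Fin n) (Fin n) ℝ) :
    HasDerivAt (orbitCurve H Ω) ⁅H, Ω⁆ 0 := by
  have hexp : ∀ A : Matrix (Fin n) (Fin n) ℝ,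
      HasDerivAt (fun t : ℝ => NormedSpace.exp (t • A)) A 0 := fun A =>
    (hasDerivAt_exp_smul_const (𝕂 := ℝ) A (0 : ℝ)).congr_deriv (by simp)
  have hexp_neg : HasDerivAt (fun t : ℝ => NormedSpace.exp (-(t • Ω))) (-Ω) 0 := by
    simpa only [smul_neg] using hexp (-Ω)
  refine ((hexp_neg.mul_const H).mul (hexp Ω)).congr_deriv ?_
  simp only [zero_smul, neg_zero, NormedSpace.exp_zero, mul_one, one_mul, Ring.lie_def]
  noncomm_ring

theorem hasDerivAt_lie_const {γ : ℝ → Matrix (Fin n) (Fin n) ℝ} {X : Matrix (Fin n) (Fin n) ℝ}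
    {t : ℝ} (hγ : HasDerivAt γ X t) (A : Matrix (Fin n) (Fin n) ℝ) :
    HasDerivAt (fun s => ⁅γ s, A⁆) ⁅X, A⁆ t :=
  (hγ.mul_const A).sub (hγ.const_mul A)

theorem orbitCurve_mem_isoSym (hH : H ∈ isoSym Λ) (hΩ : IsSkew Ω) (t : ℝ) :
    orbitCurve H Ω t ∈ isoSym Λ := by
  have hskew : (t • Ω)ᵀ = -(t • Ω) := hΩ.smul t
  have htrans : (NormedSpace.exp (t • Ω))ᵀ = NormedSpace.exp (-(t • Ω)) := by
    rw [← Matrix.exp_transpose, hskew]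
  refine ⟨?_, ?_⟩
  · rw [orbitCurve, ← htrans, Matrix.transpose_mul, Matrix.transpose_mul, transpose_transpose,
      hH.1, Matrix.mul_assoc]
  · have hinv := exp_neg_mul_exp (-(t • Ω))
    rw [neg_neg] at hinv
    rw [← hH.2, orbitCurve, Matrix.charpoly_mul_comm, ← Matrix.mul_assoc, hinv, Matrix.one_mul]

theorem IsSkew.eq_zero_of_lie_eq_zero (hΩ : IsSkew Ω) (hH : H ∈ isoSym Λ) (hlie : ⁅H, Ω⁆ = 0) :
    Ω = 0 :=
  let ⟨_, hQ⟩ := exists_isEigenframe hH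
  hQ.eq_zero_of_lie_eq_zero hΩ hlie

theorem adInv_lie (hH : H ∈ isoSym Λ) (hΩ : IsSkew Ω) : adInv H ⁅H, Ω⁆ = Ω := by
  have hex : ∃ Ω', IsSkew Ω' ∧ ⁅H, Ω'⁆ = ⁅H, Ω⁆ := ⟨Ω, hΩ, rfl⟩
  obtain ⟨hskew, hlie⟩ := hex.choose_spec
  rw [adInv, dif_pos hex, ← sub_eq_zero]
  exact (hskew.sub hΩ).eq_zero_of_lie_eq_zero hH (by rw [lie_sub, hlie, sub_self])

theorem normalMetric_lie (hH : H ∈ isoSym Λ) (h₁ : IsSkew Ω₁) (h₂ : IsSkew Ω₂) :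
    normalMetric H ⁅H, Ω₁⁆ ⁅H, Ω₂⁆ = -(Ω₁ * Ω₂).trace := by
  rw [normalMetric, adInv_lie hH h₁, adInv_lie hH h₂]

theorem dirDeriv_congr {E : Type*} [NormedAddCommGroup E] [NormedSpace ℝ E] {F G : Mat Λ → E}
    (hH : H ∈ isoSym Λ) (hΩ : IsSkew Ω) (hFG : Set.EqOn F G (isoSym Λ)) :
    dirDeriv F H ⁅H, Ω⁆ = dirDeriv G H ⁅H, Ω⁆ := by
  rw [dirDeriv, dirDeriv, adInv_lie hH hΩ]
  exact congrArg (deriv · 0) (funext fun t => hFG (orbitCurve_mem_isoSym hH hΩ t))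

theorem dirDeriv_fundField (hH : H ∈ isoSym Λ) (hΩ : IsSkew Ω) (Ω' : Mat Λ) :
    dirDeriv (fundField Ω') H ⁅H, Ω⁆ = ⁅⁅H, Ω⁆, Ω'⁆ := by
  rw [dirDeriv, adInv_lie hH hΩ]
  exact (hasDerivAt_lie_const (hasDerivAt_orbitCurve H Ω) Ω').deriv

theorem bracketField_fundField (hH : H ∈ isoSym Λ) (h₁ : IsSkew Ω₁) (h₂ : IsSkew Ω₂) :
    bracketField (fundField Ω₁) (fundField Ω₂) H = ⁅H, ⁅Ω₁, Ω₂⁆⁆ := by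
  rw [bracketField, fundField, fundField, dirDeriv_fundField hH h₁, dirDeriv_fundField hH h₂,
    leibniz_lie, ← lie_skew ⁅H, Ω₂⁆ Ω₁, sub_eq_add_neg, neg_neg]

theorem dirDeriv_normalMetric_fundField (hH : H ∈ isoSym Λ) (h₁ : IsSkew Ω₁) (h₂ : IsSkew Ω₂)
    (h₃ : IsSkew Ω₃) :
    dirDeriv (fun A => normalMetric A (fundField Ω₁ A) (fundField Ω₂ A)) H ⁅H, Ω₃⁆ = 0 := by
  have hconst : Set.EqOn (fun A => normalMetric A (fundField Ω₁ A) (fundField Ω₂ A))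
      (fun _ => -(Ω₁ * Ω₂).trace) (isoSym Λ) := fun A hA => normalMetric_lie hA h₁ h₂
  rw [dirDeriv_congr hH h₃ hconst]
  exact deriv_const 0 _

theorem koszul_fundField (hH : H ∈ isoSym Λ) (h₁ : IsSkew Ω₁) (h₂ : IsSkew Ω₂)
    (h₃ : IsSkew Ω₃) :
    koszul (fundField Ω₁) (fundField Ω₂) (fundField Ω₃) H = -(1 / 2) * (⁅Ω₁, Ω₂⁆ * Ω₃).trace := by
  rw [koszul, bracketField_fundField hH h₁ h₂, bracketField_fundField hH h₂ h₃,
    bracketField_fundField hH h₃ h₁]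
  simp only [fundField.eq_1 _ H]
  rw [dirDeriv_normalMetric_fundField hH h₂ h₃ h₁, dirDeriv_normalMetric_fundField hH h₃ h₁ h₂,
    dirDeriv_normalMetric_fundField hH h₁ h₂ h₃, normalMetric_lie hH (h₁.lie h₂) h₃,
    normalMetric_lie hH (h₂.lie h₃) h₁, normalMetric_lie hH (h₃.lie h₁) h₂,
    trace_lie_mul Ω₃ Ω₁ Ω₂, Matrix.trace_mul_comm Ω₃, Matrix.trace_mul_comm ⁅Ω₂, Ω₃⁆,
    ← trace_lie_mul Ω₁ Ω₂ Ω₃]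
  ring

theorem leviCivita_fundField (hH : H ∈ isoSym Λ) (h₁ : IsSkew Ω₁) (h₂ : IsSkew Ω₂) :
    leviCivita (fundField Ω₁) (fundField Ω₂) H = ⁅H, (1 / 2 : ℝ) • ⁅Ω₁, Ω₂⁆⁆ := by
  have hhalf : IsSkew ((1 / 2 : ℝ) • ⁅Ω₁, Ω₂⁆) := (h₁.lie h₂).smul _
  have hkoszul {Ω} (hΩ : IsSkew Ω) : normalMetric H ⁅H, (1 / 2 : ℝ) • ⁅Ω₁, Ω₂⁆⁆ (fundField Ω H) =
      koszul (fundField Ω₁) (fundField Ω₂) (fundField Ω) H := by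
    rw [koszul_fundField hH h₁ h₂ hΩ, fundField, normalMetric_lie hH hhalf hΩ, Matrix.smul_mul,
      trace_smul, smul_eq_mul, neg_mul]
  have hex : ∃ W, W ∈ isoTangent H ∧ ∀ Ω, IsSkew Ω →
      normalMetric H W (fundField Ω H) = koszul (fundField Ω₁) (fundField Ω₂) (fundField Ω) H :=
    ⟨_, ⟨_, hhalf, rfl⟩, fun _ => hkoszul⟩
  rw [leviCivita, dif_pos hex]
  obtain ⟨⟨Ω, hΩ, hlie⟩, hW⟩ := hex.choose_spec
  rw [← hlie] at hW ⊢
  have hdiff := hΩ.sub hhalf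
  have hmetric := (hW _ hdiff).trans (hkoszul hdiff).symm
  rw [fundField, normalMetric_lie hH hΩ hdiff, normalMetric_lie hH hhalf hdiff, neg_inj,
    ← sub_eq_zero, ← trace_sub, ← Matrix.sub_mul] at hmetric
  rw [sub_eq_zero.1 (hdiff.eq_zero_of_trace_mul_self hmetric)]

end Orbit

section Potential

variable {n : ℕ}

theorem diagPotential_eq (H : Matrix (Fin n) (Fin n) ℝ) :
    diagPotential H = (1 / 2 : ℝ) * (H.diag ⬝ᵥ H.diag) := by
  simp only [diagPotential, dotProduct, diag_apply, pow_two]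

theorem hasDerivAt_diag_dotProduct_diag {γ δ : ℝ → Matrix (Fin n) (Fin n) ℝ}
    {X Y : Matrix (Fin n) (Fin n) ℝ} {t : ℝ} (hγ : HasDerivAt γ X t) (hδ : HasDerivAt δ Y t) :
    HasDerivAt (fun s => (γ s).diag ⬝ᵥ (δ s).diag)
      (X.diag ⬝ᵥ (δ t).diag + (γ t).diag ⬝ᵥ Y.diag) t := by
  have hentry (i : Fin n) {η : ℝ → Matrix (Fin n) (Fin n) ℝ} {Z : Matrix (Fin n) (Fin n) ℝ}
      (hη : HasDerivAt η Z t) : HasDerivAt (fun s => η s i i) (Z i i) t :=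
    (entryLinearMap ℝ ℝ i i).toContinuousLinearMap.hasFDerivAt.comp_hasDerivAt t hη
  refine (HasDerivAt.fun_sum fun i _ => (hentry i hγ).mul (hentry i hδ)).congr_deriv ?_
  exact Finset.sum_add_distrib

theorem contDiff_diagPotential :
    ContDiff ℝ ∞ (diagPotential : Matrix (Fin n) (Fin n) ℝ → ℝ) :=
  contDiff_const.mul (ContDiff.sum fun i _ =>
    (entryLinearMap ℝ ℝ i i).toContinuousLinearMap.contDiff.pow 2)

variable {Λ : Finset ℝ} {H Ω Ω₁ Ω₂ : Mat Λ}

theorem dirDeriv_diagPotential (hH : H ∈ isoSym Λ) (hΩ : IsSkew Ω) :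
    dirDeriv diagPotential H ⁅H, Ω⁆ = H.diag ⬝ᵥ ⁅H, Ω⁆.diag := by
  have hcurve := hasDerivAt_orbitCurve H Ω
  have hderiv := (hasDerivAt_diag_dotProduct_diag hcurve hcurve).const_mul (1 / 2 : ℝ)
  rw [dirDeriv, adInv_lie hH hΩ]
  simp_rw [diagPotential_eq]
  rw [hderiv.deriv, orbitCurve_zero, dotProduct_comm]
  ring

theorem hessian_lie (hH : H ∈ isoSym Λ) (h₁ : IsSkew Ω₁) (h₂ : IsSkew Ω₂) :
    hessian diagPotential H ⁅H, Ω₁⁆ ⁅H, Ω₂⁆ =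
      ⁅H, Ω₁⁆.diag ⬝ᵥ ⁅H, Ω₂⁆.diag + H.diag ⬝ᵥ ⁅⁅H, Ω₁⁆, Ω₂⁆.diag
        - H.diag ⬝ᵥ ⁅H, (1 / 2 : ℝ) • ⁅Ω₁, Ω₂⁆⁆.diag := by
  have hcurve := hasDerivAt_orbitCurve H Ω₁
  rw [hessian, adInv_lie hH h₁, adInv_lie hH h₂, hessianField, leviCivita_fundField hH h₁ h₂,
    dirDeriv_diagPotential hH ((h₁.lie h₂).smul _)]
  simp only [fundField]
  rw [dirDeriv_congr hH h₁ fun A hA => dirDeriv_diagPotential hA h₂, dirDeriv, adInv_lie hH h₁,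
    (hasDerivAt_diag_dotProduct_diag hcurve (hasDerivAt_lie_const hcurve Ω₂)).deriv,
    orbitCurve_zero]

end Potential

section CharValues

variable {Λ : Finset ℝ} {H X : Mat Λ}

theorem contDiff_det {m : Type*} [Fintype m] [DecidableEq m] :
    ContDiff ℝ ∞ (det : Matrix m m ℝ → ℝ) := by
  simp only [funext fun A : Matrix m m ℝ => A.det_apply]
  exact ContDiff.sum fun σ _ => (contDiff_prod fun i _ =>
    (entryLinearMap ℝ ℝ (σ i) i).toContinuousLinearMap.contDiff).const_smul (Equiv.Perm.sign σ)

/-- The values of the characteristic polynomial at the elements of `Λ`; their common zeros are the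
matrices with spectrum `Λ`. -/
noncomputable def charValues (Λ : Finset ℝ) (X : Mat Λ) : Fin Λ.card → ℝ :=
  fun i => (scalar (Fin Λ.card) (Λ.orderEmbOfFin rfl i) - X).det

theorem mem_isoSym_iff_charValues : H ∈ isoSym Λ ↔ Hᵀ = H ∧ charValues Λ H = 0 :=
  mem_isoSym_iff_det.trans (and_congr_right fun _ => funext_iff.symm)

theorem contDiff_charValues : ContDiff ℝ ∞ (charValues Λ) :=
  contDiff_pi.2 fun _ => contDiff_det.comp (contDiff_const.sub contDiff_id)

theorem hasFDerivAt_charValues (H : Mat Λ) :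
    HasFDerivAt (charValues Λ) (fderiv ℝ (charValues Λ) H) H :=
  (contDiff_charValues.differentiable (by simp) H).hasFDerivAt

theorem fderiv_charValues_of_mem_isoTangent (hH : H ∈ isoSym Λ) (hX : X ∈ isoTangent H) :
    fderiv ℝ (charValues Λ) H X = 0 := by
  obtain ⟨Ω, hΩ, rfl⟩ := hX
  have hderiv := (hasFDerivAt_charValues H).comp_hasDerivAt_of_eq 0 (hasDerivAt_orbitCurve H Ω)
    (orbitCurve_zero H Ω).symm
  have hconst : charValues Λ ∘ orbitCurve H Ω = fun _ => 0 :=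
    funext fun t => (mem_isoSym_iff_charValues.1 (orbitCurve_mem_isoSym hH hΩ t)).2
  exact hderiv.unique (hconst ▸ hasDerivAt_const 0 0)

namespace IsEigenframe

variable {Q : Mat Λ} (hQ : IsEigenframe H Q (Λ.orderEmbOfFin rfl))
include hQ

theorem charValues_add_smul (a : Fin Λ.card → ℝ) (t : ℝ) (i : Fin Λ.card) :
    charValues Λ (H + t • (Q * diagonal a * Qᵀ)) i = -(t * a i) *
      ∏ k ∈ Finset.univ.erase i, (Λ.orderEmbOfFin rfl i - Λ.orderEmbOfFin rfl k - t * a k) := by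
  set l := Λ.orderEmbOfFin rfl
  have hscalar : scalar (Fin Λ.card) (l i) = Q * scalar (Fin Λ.card) (l i) * Qᵀ := by
    rw [← (Matrix.scalar_commute (l i) (fun _ => mul_comm _ _) Q).eq, Matrix.mul_assoc,
      hQ.mul_transpose_self, Matrix.mul_one]
  have hconj : scalar (Fin Λ.card) (l i) - (H + t • (Q * diagonal a * Qᵀ)) =
      Q * diagonal (fun k => l i - l k - t * a k) * Qᵀ := by
    rw [hscalar, hQ.eq_conj hQ.mul_eq, ← Matrix.smul_mul, ← Matrix.mul_smul, ← Matrix.add_mul,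
      ← Matrix.sub_mul, ← Matrix.mul_add, ← Matrix.mul_sub, ← diagonal_smul, diagonal_add,
      scalar_apply, diagonal_sub]
    simp only [Pi.smul_apply, smul_eq_mul, sub_sub]
  rw [charValues, hconj, det_mul, det_mul, mul_right_comm, ← det_mul, hQ.mul_transpose_self,
    det_one, one_mul, det_diagonal, ← Finset.mul_prod_erase _ _ (Finset.mem_univ i), sub_self,
    zero_sub]

theorem fderiv_charValues (a : Fin Λ.card → ℝ) (i : Fin Λ.card) :
    fderiv ℝ (charValues Λ) H (Q * diagonal a * Qᵀ) i =
      -a i * ∏ k ∈ Finset.univ.erase i, (Λ.orderEmbOfFin rfl i - Λ.orderEmbOfFin rfl k) := by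
  have hline := hasDerivAt_pi.1 ((hasFDerivAt_charValues H).hasLineDerivAt (Q * diagonal a * Qᵀ)) i
  simp only [hQ.charValues_add_smul] at hline
  have hprod : DifferentiableAt ℝ (fun t : ℝ => ∏ k ∈ Finset.univ.erase i,
      (Λ.orderEmbOfFin rfl i - Λ.orderEmbOfFin rfl k - t * a k)) 0 := by
    fun_prop
  have hmul := ((hasDerivAt_id (0 : ℝ)).mul_const (a i)).neg.mul hprod.hasDerivAt
  exact (hline.unique hmul).trans (by simp)

theorem prod_sub_ne_zero (i : Fin Λ.card) :
    ∏ k ∈ Finset.univ.erase i, (Λ.orderEmbOfFin rfl i - Λ.orderEmbOfFin rfl k) ≠ 0 :=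
  Finset.prod_ne_zero_iff.2 fun _ hk =>
    sub_ne_zero.2 (hQ.injective.ne (Finset.ne_of_mem_erase hk).symm)

theorem exists_fderiv_charValues_eq (c : Fin Λ.card → ℝ) :
    ∃ a, fderiv ℝ (charValues Λ) H (Q * diagonal a * Qᵀ) = c := by
  refine ⟨fun i => -(c i / ∏ k ∈ Finset.univ.erase i,
    (Λ.orderEmbOfFin rfl i - Λ.orderEmbOfFin rfl k)), funext fun i => ?_⟩
  rw [hQ.fderiv_charValues, neg_neg, div_mul_cancel₀ _ (hQ.prod_sub_ne_zero i)]

theorem mem_isoTangent_of_fderiv_charValues_eq_zero (hH : H ∈ isoSym Λ) (hX : Xᵀ = X)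
    (h0 : fderiv ℝ (charValues Λ) H X = 0) : X ∈ isoTangent H := by
  let D := Q * diagonal (Qᵀ * X * Q).diag * Qᵀ
  have hD : Dᵀ = D := by
    rw [Matrix.transpose_mul, Matrix.transpose_mul, transpose_transpose, diagonal_transpose,
      ← Matrix.mul_assoc]
  have hoff : X - D ∈ isoTangent H := hQ.mem_isoTangent (by rw [transpose_sub, hX, hD]) fun i => by
    rw [Matrix.mul_sub, Matrix.sub_mul, hQ.coord_conj, Matrix.sub_apply, diagonal_apply_eq,
      diag_apply, sub_self]
  have hderiv := fderiv_charValues_of_mem_isoTangent hH hoff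
  rw [map_sub, h0, zero_sub, neg_eq_zero] at hderiv
  refine hQ.mem_isoTangent hX fun i => neg_eq_zero.1 ?_
  have hi := congrFun hderiv i
  rw [hQ.fderiv_charValues] at hi
  exact (mul_eq_zero.1 hi).resolve_right (hQ.prod_sub_ne_zero i)

end IsEigenframe

end CharValues

/-! ### The critical set -/

section CritSet

theorem levelMean_diag_lie {m κ K : Type*} [Fintype m] [DecidableEq m] [DecidableEq κ] [Field K]
    [CharZero K] {f : m → κ} {A : Matrix m m K} (hA : ∀ i j, f i ≠ f j → A i j = 0)
    (B : Matrix m m K) : ⁅A, B⁆.diag ∈ LinearMap.ker (levelMean f : (m → K) →ₗ[K] m → K) := by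
  refine mem_ker_levelMean.2 fun i => ?_
  let e : m → K := fun j => if f j = f i then 1 else 0
  have he : ⁅diagonal e, A⁆ = 0 := diagonal_lie_eq_zero_iff.2 fun j k hjk =>
    hA j k fun hf => hjk (by simp only [e, hf])
  calc ∑ j with f j = f i, ⁅A, B⁆.diag j = e ⬝ᵥ ⁅A, B⁆.diag := by
        simp only [e, dotProduct, ite_mul, one_mul, zero_mul, Finset.sum_filter]
    _ = 0 := by rw [dotProduct_diag_lie, he, Matrix.zero_mul, trace_zero]

theorem eq_zero_of_mem_ker_levelMean {m κ K : Type*} [Fintype m] [DecidableEq κ] [Field K]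
    [CharZero K] {f : m → κ} {u : m → K} (hu : u ∈ LinearMap.ker (levelMean f))
    (hconst : ∀ i j, f i = f j → u i = u j) : u = 0 :=
  (levelMean_eq_self_iff.2 hconst).symm.trans hu

variable {Λ : Finset ℝ} {H X Y : Mat Λ}

/-- The matrices in `Sym(Λ)` that commute with their own diagonal. These are the critical points
of the diagonal potential, see `isGradientAt_zero_iff`. -/
def critSet (Λ : Finset ℝ) : Set (Mat Λ) :=
  {H | H ∈ isoSym Λ ∧ ⁅diagonal H.diag, H⁆ = 0}

theorem apply_eq_zero_of_mem_critSet (hH : H ∈ critSet Λ) (i j : Fin Λ.card)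
    (hij : H.diag i ≠ H.diag j) : H i j = 0 :=
  diagonal_lie_eq_zero_iff.1 hH.2 i j hij

theorem diag_mem_means (hH : H ∈ critSet Λ) (i : Fin Λ.card) :
    H.diag i ∈ Λ.powerset.image mean := by
  rw [← levelMean_eq_self_iff.2 fun (i j : Fin Λ.card) (hij : H.diag i = H.diag j) => hij]
  exact levelMean_diag_mem_means hH.1.2 (apply_eq_zero_of_mem_critSet hH) i

/-- The diagonal takes finitely many values on the critical set, so it is locally constant. -/
theorem eventually_diag_eq (H : Mat Λ) :
    ∀ᶠ X in 𝓝 H, X ∈ critSet Λ → X.diag = H.diag := by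
  let means : Finset ℝ := Λ.powerset.image mean
  have hdiag : Continuous fun X : Mat Λ => X.diag :=
    (diagLinearMap (Fin Λ.card) ℝ ℝ).toContinuousLinearMap.continuous
  have hev : ∀ i, ∀ᶠ X : Mat Λ in 𝓝 H, X.diag i ∉ means.erase (H.diag i) := fun i =>
    ((continuous_apply i).comp hdiag).continuousAt.eventually_mem
      ((means.erase (H.diag i)).finite_toSet.isClosed.isOpen_compl.mem_nhds (by simp))
  filter_upwards [Filter.eventually_all.2 hev] with X hX hcrit
  refine funext fun i => by_contra fun hne => hX i ?_
  exact Finset.mem_erase.2 ⟨hne, diag_mem_means hcrit i⟩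

/-- Otherwise the eigenvalues of two of the joint diagonal blocks of `H` and `Diag(e)` would be
disjoint parts of `Λ` with equal means. -/
theorem StronglyDisjoint.eq_of_diagonal_lie_eq_zero (hΛ : StronglyDisjoint Λ) (hH : H ∈ critSet Λ)
    {e : Fin Λ.card → ℝ} (he : ⁅diagonal e, H⁆ = 0) {i j : Fin Λ.card}
    (hij : H.diag i = H.diag j) : e i = e j := by
  let f : Fin Λ.card → ℝ ×ₗ ℝ := fun k => toLex (H.diag k, e k)
  have hf : ∀ k l, f k = f l ↔ H.diag k = H.diag l ∧ e k = e l := fun k l => by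
    rw [toLex_inj, Prod.mk_inj]
  have hmean : levelMean f H.diag = H.diag := levelMean_eq_self_iff.2 fun k l h => ((hf k l).1 h).1
  have hblock : ∀ k l, f k ≠ f l → H k l = 0 := fun k l hkl => by
    by_cases hd : H.diag k = H.diag l
    · exact diagonal_lie_eq_zero_iff.1 he k l fun h => hkl ((hf k l).2 ⟨hd, h⟩)
    · exact apply_eq_zero_of_mem_critSet hH k l hd
  refine ((hf i j).1 (hΛ.eq_of_levelMean_diag_eq hH.1.2 hblock ?_)).2
  rw [hmean, hij]

/-- The quadratic form `e ↦ e ⬝ᵥ diag [H, [Diag(e), H]]` is definite on the vectors with vanishing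
level means, so `e ↦ diag [H, [Diag(e), H]]` is injective and hence surjective there. -/
theorem StronglyDisjoint.exists_diag_lie_eq (hΛ : StronglyDisjoint Λ) (hH : H ∈ critSet Λ)
    {u : Fin Λ.card → ℝ} (hu : u ∈ LinearMap.ker (levelMean H.diag)) :
    ∃ e : Fin Λ.card → ℝ, ⁅H, ⁅diagonal e, H⁆⁆.diag = u := by
  let M : (Fin Λ.card → ℝ) →ₗ[ℝ] Fin Λ.card → ℝ :=
    diagLinearMap (Fin Λ.card) ℝ ℝ ∘ₗ (LieAlgebra.ad ℝ (Mat Λ) H : Mat Λ →ₗ[ℝ] Mat Λ) ∘ₗ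
      (-LieAlgebra.ad ℝ (Mat Λ) H : Mat Λ →ₗ[ℝ] Mat Λ) ∘ₗ diagonalLinearMap (Fin Λ.card) ℝ ℝ
  have hM (e) : M e = ⁅H, ⁅diagonal e, H⁆⁆.diag := by
    change ⁅H, -⁅H, diagonal e⁆⁆.diag = _
    rw [lie_skew]
  have hmaps : ∀ e ∈ LinearMap.ker (levelMean H.diag), M e ∈ LinearMap.ker (levelMean H.diag) :=
    fun e _ => hM e ▸ levelMean_diag_lie (apply_eq_zero_of_mem_critSet hH) _
  have hinj : Function.Injective (M.restrict hmaps) := by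
    refine (injective_iff_map_eq_zero _).2 fun ⟨e, he⟩ h0 => Subtype.ext ?_
    have hMe : M e = 0 := congrArg Subtype.val h0
    have hskew := isSkew_lie_of_symm (diagonal_transpose e) hH.1.1
    have hcomm : ⁅diagonal e, H⁆ = 0 := hskew.eq_zero_of_trace_mul_self <| by
      rw [← dotProduct_diag_lie, ← hM, hMe, dotProduct_zero]
    exact eq_zero_of_mem_ker_levelMean he fun i j => hΛ.eq_of_diagonal_lie_eq_zero hH hcomm
  obtain ⟨e, he⟩ := LinearMap.injective_iff_surjective.1 hinj ⟨u, hu⟩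
  exact ⟨e, (hM e).symm.trans (congrArg Subtype.val he)⟩

end CritSet

section CritChart

variable {Λ : Finset ℝ} {H X : Mat Λ}

/-- The tangent vectors to `Sym(Λ)` at `H` that commute with `Diag(H.diag)` and have zero
diagonal. This is the tangent space of the critical set at its point `H`. -/
def critTangent (H : Mat Λ) : Set (Mat Λ) :=
  {X | X ∈ isoTangent H ∧ ⁅diagonal H.diag, X⁆ = 0 ∧ X.diag = 0}

/-- Equations for the critical set near its points with diagonal `d`: `X` is symmetric and commutes
with `Diag(d)`, it has spectrum `Λ`, and its diagonal is constant on the level sets of `d`. -/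
noncomputable def critFun (d : Fin Λ.card → ℝ) (X : Mat Λ) :
    Mat Λ × (Fin Λ.card → ℝ) × (Fin Λ.card → ℝ) :=
  (X - blockSymm d X, charValues Λ X, X.diag - levelMean d X.diag)

/-- The derivative of `critFun d` at `H`. -/
noncomputable def critFunDeriv (d : Fin Λ.card → ℝ) (H : Mat Λ) :
    Mat Λ →L[ℝ] Mat Λ × (Fin Λ.card → ℝ) × (Fin Λ.card → ℝ) :=
  (LinearMap.toContinuousLinearMap (1 - blockSymm d)).prod ((fderiv ℝ (charValues Λ) H).prod
    (LinearMap.toContinuousLinearMap ((1 - levelMean d) ∘ₗ diagLinearMap (Fin Λ.card) ℝ ℝ)))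

theorem critFunDeriv_apply (d : Fin Λ.card → ℝ) (H X : Mat Λ) : critFunDeriv d H X =
    (X - blockSymm d X, fderiv ℝ (charValues Λ) H X, X.diag - levelMean d X.diag) :=
  rfl

theorem contDiff_critFun (d : Fin Λ.card → ℝ) : ContDiff ℝ ∞ (critFun d) :=
  (LinearMap.toContinuousLinearMap (1 - blockSymm d : Mat Λ →ₗ[ℝ] Mat Λ)).contDiff.prodMk <|
    contDiff_charValues.prodMk (LinearMap.toContinuousLinearMap
      ((1 - levelMean d) ∘ₗ diagLinearMap (Fin Λ.card) ℝ ℝ)).contDiff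

theorem hasFDerivAt_critFun (d : Fin Λ.card → ℝ) (H : Mat Λ) :
    HasFDerivAt (critFun d) (critFunDeriv d H) H :=
  (LinearMap.toContinuousLinearMap (1 - blockSymm d : Mat Λ →ₗ[ℝ] Mat Λ)).hasFDerivAt.prodMk <|
    (hasFDerivAt_charValues H).prodMk (LinearMap.toContinuousLinearMap
      ((1 - levelMean d) ∘ₗ diagLinearMap (Fin Λ.card) ℝ ℝ)).hasFDerivAt

theorem critFun_mem (d : Fin Λ.card → ℝ) (X : Mat Λ) :
    critFun d X ∈ (LinearMap.ker (blockSymm d)).prod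
      ((⊤ : Submodule ℝ (Fin Λ.card → ℝ)).prod (LinearMap.ker (levelMean d))) := by
  refine ⟨?_, Submodule.mem_top, ?_⟩
  · rw [LinearMap.IsIdempotentElem.ker_eq_range_one_sub (isIdempotentElem_blockSymm d)]
    exact LinearMap.mem_range_self _ X
  · rw [LinearMap.IsIdempotentElem.ker_eq_range_one_sub (isIdempotentElem_levelMean d)]
    exact LinearMap.mem_range_self _ X.diag

theorem blockSymm_diag_eq_self_iff :
    blockSymm H.diag X = X ↔ Xᵀ = X ∧ ⁅diagonal H.diag, X⁆ = 0 := by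
  rw [blockSymm_eq_self_iff, diagonal_lie_eq_zero_iff]

theorem exists_blockSymm_eq_self_fderiv_charValues_eq (hH : H ∈ critSet Λ) (c : Fin Λ.card → ℝ) :
    ∃ X, blockSymm H.diag X = X ∧ fderiv ℝ (charValues Λ) H X = c := by
  obtain ⟨Q, hQ⟩ := exists_isEigenframe hH.1
  obtain ⟨m, hm⟩ := hQ.exists_mul_eq_of_lie_eq_zero (by rw [← lie_skew, hH.2, neg_zero])
  obtain ⟨a, ha⟩ := hQ.exists_fderiv_charValues_eq c
  refine ⟨_, blockSymm_diag_eq_self_iff.2 ⟨?_, hQ.ext_coord fun i j => ?_⟩, ha⟩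
  · rw [Matrix.transpose_mul, Matrix.transpose_mul, transpose_transpose, diagonal_transpose,
      ← Matrix.mul_assoc]
  · rw [hQ.coord_lie hm, hQ.coord_conj, Matrix.mul_zero, Matrix.zero_mul, Matrix.zero_apply]
    obtain rfl | hij := eq_or_ne i j
    · rw [sub_self, zero_mul]
    · rw [diagonal_apply_ne _ hij, mul_zero]

theorem exists_blockSymm_eq_self_diag_eq (hΛ : StronglyDisjoint Λ) (hH : H ∈ critSet Λ)
    {u : Fin Λ.card → ℝ} (hu : u ∈ LinearMap.ker (levelMean H.diag)) :
    ∃ X ∈ isoTangent H, blockSymm H.diag X = X ∧ X.diag = u := by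
  obtain ⟨e, he⟩ := hΛ.exists_diag_lie_eq hH hu
  have hskew := isSkew_lie_of_symm (diagonal_transpose e) hH.1.1
  have hcomm : ⁅diagonal H.diag, ⁅diagonal e, H⁆⁆ = 0 :=
    diagonal_lie_eq_zero_iff.2 fun i j hij => by
      rw [diagonal_lie_apply, apply_eq_zero_of_mem_critSet hH i j hij, mul_zero]
  refine ⟨_, ⟨_, hskew, rfl⟩, blockSymm_diag_eq_self_iff.2 ⟨hskew.transpose_lie hH.1.1, ?_⟩, he⟩
  rw [leibniz_lie, hH.2, hcomm, zero_lie, lie_zero, add_zero]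

theorem range_critFunDeriv (hΛ : StronglyDisjoint Λ) (hH : H ∈ critSet Λ) :
    (critFunDeriv H.diag H).range = (LinearMap.ker (blockSymm H.diag)).prod
      ((⊤ : Submodule ℝ (Fin Λ.card → ℝ)).prod (LinearMap.ker (levelMean H.diag))) := by
  apply le_antisymm
  · rintro _ ⟨X, rfl⟩
    exact ⟨(critFun_mem _ X).1, Submodule.mem_top, (critFun_mem _ X).2.2⟩
  · rintro ⟨S, c, u⟩ ⟨hS, -, hu⟩
    obtain ⟨X, hX, hXc⟩ := exists_blockSymm_eq_self_fderiv_charValues_eq hH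
      (c - fderiv ℝ (charValues Λ) H S)
    have hker : u - ((S + X).diag - levelMean H.diag (S + X).diag) ∈
        LinearMap.ker (levelMean H.diag) := Submodule.sub_mem _ hu (critFun_mem H.diag (S + X)).2.2
    obtain ⟨Y, hY, hYblock, hYdiag⟩ := exists_blockSymm_eq_self_diag_eq hΛ hH hker
    have hYker : levelMean H.diag Y.diag = 0 := hYdiag ▸ hker
    refine ⟨S + X + Y, Prod.ext ?_ (Prod.ext ?_ ?_)⟩
    · change S + X + Y - blockSymm H.diag (S + X + Y) = S
      rw [map_add, map_add, LinearMap.mem_ker.1 hS, hX, hYblock]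
      abel
    · change fderiv ℝ (charValues Λ) H (S + X + Y) = c
      rw [map_add, map_add, hXc, fderiv_charValues_of_mem_isoTangent hH.1 hY]
      abel
    · change (S + X + Y).diag - levelMean H.diag (S + X + Y).diag = u
      rw [diag_add, map_add, hYker, hYdiag, add_zero]
      abel

theorem mem_ker_critFunDeriv_iff (hH : H ∈ critSet Λ) :
    X ∈ (critFunDeriv H.diag H).ker ↔ X ∈ critTangent H := by
  have hker : X ∈ (critFunDeriv H.diag H).ker ↔ blockSymm H.diag X = X ∧
      fderiv ℝ (charValues Λ) H X = 0 ∧ levelMean H.diag X.diag = X.diag := by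
    change critFunDeriv H.diag H X = 0 ↔ _
    rw [critFunDeriv_apply, Prod.mk_eq_zero, Prod.mk_eq_zero, sub_eq_zero, sub_eq_zero,
      eq_comm (a := X), eq_comm (a := X.diag)]
  rw [hker, blockSymm_diag_eq_self_iff]
  constructor
  · rintro ⟨⟨hsymm, hcomm⟩, hchar, hmean⟩
    obtain ⟨Q, hQ⟩ := exists_isEigenframe hH.1
    have htan := hQ.mem_isoTangent_of_fderiv_charValues_eq_zero hH.1 hsymm hchar
    obtain ⟨Ω, -, rfl⟩ := id htan
    exact ⟨htan, hcomm,
      hmean.symm.trans (levelMean_diag_lie (apply_eq_zero_of_mem_critSet hH) Ω)⟩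
  · rintro ⟨htan, hcomm, hdiag⟩
    refine ⟨⟨?_, hcomm⟩, fderiv_charValues_of_mem_isoTangent hH.1 htan, by rw [hdiag, map_zero]⟩
    obtain ⟨Ω, hΩ, rfl⟩ := htan
    exact hΩ.transpose_lie hH.1.1

theorem eventually_mem_critSet_iff (H : Mat Λ) :
    ∀ᶠ X in 𝓝 H, X ∈ critSet Λ ↔ critFun H.diag X = 0 := by
  filter_upwards [eventually_diag_eq H] with X hdiag
  rw [critFun, Prod.mk_eq_zero, Prod.mk_eq_zero, sub_eq_zero, sub_eq_zero, eq_comm (a := X),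
    eq_comm (a := X.diag), blockSymm_eq_self_iff, levelMean_eq_self_iff]
  constructor
  · intro hX
    rw [← hdiag hX]
    exact ⟨⟨hX.1.1, apply_eq_zero_of_mem_critSet hX⟩, (mem_isoSym_iff_charValues.1 hX.1).2,
      fun i j => id⟩
  · rintro ⟨⟨hsymm, hblock⟩, hchar, hlevel⟩
    exact ⟨mem_isoSym_iff_charValues.2 ⟨hsymm, hchar⟩, diagonal_lie_eq_zero_iff.2 fun i j hij =>
      hblock i j fun h => hij (hlevel i j h)⟩

theorem isCleanEquationAt_critFun (hΛ : StronglyDisjoint Λ) (hH : H ∈ critSet Λ) :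
    IsCleanEquationAt (critSet Λ) (critFun H.diag) (critFunDeriv H.diag H) H where
  contDiff := contDiff_critFun _
  hasFDerivAt := hasFDerivAt_critFun _ _
  mem_range := by
    rw [range_critFunDeriv hΛ hH]
    exact critFun_mem _
  eventually_mem_iff := eventually_mem_critSet_iff H

theorem tangentSpaceAt_eq_critTangent (hΛ : StronglyDisjoint Λ) (hH : H ∈ critSet Λ)
    {S : Set (Mat Λ)} (hS : ∀ᶠ X in 𝓝 H, X ∈ S ↔ X ∈ critSet Λ) :
    (tangentSpaceAt S H : Set (Mat Λ)) = critTangent H := by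
  rw [((isCleanEquationAt_critFun hΛ hH).congr_set hS).tangentSpaceAt_eq_ker
    (hS.self_of_nhds.2 hH)]
  exact Set.ext fun X => mem_ker_critFunDeriv_iff hH

end CritChart

/-! ### The Hessian on the normal space -/

section Wedge

variable {m ι R : Type*} [Fintype m] [CommRing R]

/-- The skew symmetric matrix `u vᵀ - v uᵀ`. For eigenvectors `u`, `v` of `H` the vectors
`[H, wedge u v]` are the off block-diagonal normal directions `N_{pq,ij}`. -/
def wedge (u v : m → R) : Matrix m m R := vecMulVec u v - vecMulVec v u

theorem isSkew_wedge {n : ℕ} (u v : Fin n → ℝ) : IsSkew (wedge u v) := by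
  rw [IsSkew, wedge, transpose_sub, transpose_vecMulVec, transpose_vecMulVec, neg_sub]

theorem trace_mul_wedge (A : Matrix m m R) (u v : m → R) :
    (A * wedge u v).trace = v ⬝ᵥ (A *ᵥ u) - u ⬝ᵥ (A *ᵥ v) := by
  rw [wedge, Matrix.mul_sub, trace_sub, mul_vecMulVec, mul_vecMulVec, trace_vecMulVec,
    trace_vecMulVec, dotProduct_comm, dotProduct_comm (A *ᵥ v)]

theorem trace_mul_wedge_col (A : Matrix m m R) (Q : Matrix m ι R) (i j : ι) :
    (A * wedge (Q.col i) (Q.col j)).trace = (Qᵀ * A * Q) j i - (Qᵀ * A * Q) i j := by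
  rw [trace_mul_wedge, Matrix.mul_assoc]
  rfl

theorem lie_wedge [DecidableEq m] {A : Matrix m m R} (hA : Aᵀ = A) {u v : m → R} {a b : R}
    (hu : A *ᵥ u = a • u) (hv : A *ᵥ v = b • v) :
    ⁅A, wedge u v⁆ = (a - b) • (vecMulVec u v + vecMulVec v u) := by
  rw [Ring.lie_def, wedge, Matrix.mul_sub, Matrix.sub_mul, mul_vecMulVec, mul_vecMulVec,
    vecMulVec_mul, vecMulVec_mul, ← mulVec_transpose, ← mulVec_transpose, hA, hu, hv,
    smul_vecMulVec, smul_vecMulVec, vecMulVec_smul, vecMulVec_smul]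
  module

end Wedge

section CritHessian

variable {Λ : Finset ℝ} {H X Y Ω : Mat Λ}

theorem hessian_lie_of_mem_critSet (hH : H ∈ critSet Λ) (hX : X ∈ isoTangent H) (hΩ : IsSkew Ω) :
    hessian diagPotential H X ⁅H, Ω⁆ =
      X.diag ⬝ᵥ ⁅H, Ω⁆.diag + (⁅diagonal H.diag, X⁆ * Ω).trace := by
  obtain ⟨Ω', hΩ', rfl⟩ := hX
  rw [hessian_lie hH.1 hΩ' hΩ, dotProduct_diag_lie H.diag ⁅H, Ω'⁆, dotProduct_diag_lie H.diag H,
    hH.2, Matrix.zero_mul, trace_zero, sub_zero]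

theorem hessian_eq_dotProduct_diag (hH : H ∈ critSet Λ) (hX : X ∈ isoTangent H)
    (hY : Y ∈ isoTangent H) (hcomm : ⁅diagonal H.diag, X⁆ = 0) :
    hessian diagPotential H X Y = X.diag ⬝ᵥ Y.diag := by
  obtain ⟨Ω, hΩ, rfl⟩ := hY
  rw [hessian_lie_of_mem_critSet hH hX hΩ, hcomm, Matrix.zero_mul, trace_zero, add_zero]

theorem exists_hessian_eq_trace_mul (hH : H ∈ critSet Λ) (hY : Y ∈ isoTangent H) :
    ∃ M : Mat Λ, ∀ X ∈ isoTangent H, hessian diagPotential H X Y = (X * M).trace := by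
  obtain ⟨Ω, hΩ, rfl⟩ := hY
  refine ⟨diagonal ⁅H, Ω⁆.diag - ⁅diagonal H.diag, Ω⁆, fun X hX => ?_⟩
  rw [hessian_lie_of_mem_critSet hH hX hΩ, Matrix.mul_sub, trace_sub, ← trace_lie_mul,
    ← lie_skew X, Matrix.neg_mul, trace_neg, sub_neg_eq_add, trace_mul_comm X,
    trace_diagonal_mul, dotProduct_comm X.diag]

theorem hessian_comm (hH : H ∈ critSet Λ) (hX : X ∈ isoTangent H) (hY : Y ∈ isoTangent H) :
    hessian diagPotential H X Y = hessian diagPotential H Y X := by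
  obtain ⟨Ω₁, h₁, rfl⟩ := id hX
  obtain ⟨Ω₂, h₂, rfl⟩ := id hY
  have hzero : H.diag ⬝ᵥ ⁅H, ⁅Ω₁, Ω₂⁆⁆.diag = 0 := by
    rw [dotProduct_diag_lie, hH.2, Matrix.zero_mul, trace_zero]
  have hjacobi : ⁅H, ⁅Ω₁, Ω₂⁆⁆ = ⁅⁅H, Ω₁⁆, Ω₂⁆ - ⁅⁅H, Ω₂⁆, Ω₁⁆ := by
    rw [leibniz_lie, ← lie_skew Ω₁, sub_eq_add_neg]
  rw [hjacobi, diag_sub, dotProduct_sub, sub_eq_zero, dotProduct_diag_lie,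
    dotProduct_diag_lie] at hzero
  rw [hessian_lie_of_mem_critSet hH hX h₂, hessian_lie_of_mem_critSet hH hY h₁, hzero,
    dotProduct_comm]

/-- The orthogonal complement of `critTangent H` in the tangent space of `Sym(Λ)` at `H`, as a
linear subspace; see `mem_critNormal_iff`. -/
def critNormal (H : Mat Λ) : Submodule ℝ (Mat Λ) where
  carrier := {X | ∃ Ω, IsSkew Ω ∧
    (∀ Ω', IsSkew Ω' → ⁅H, Ω'⁆ ∈ critTangent H → (Ω * Ω').trace = 0) ∧ ⁅H, Ω⁆ = X}
  zero_mem' := ⟨0, isSkew_iff_mem_so.2 (zero_mem _),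
    fun _ _ _ => by rw [Matrix.zero_mul, trace_zero], lie_zero H⟩
  add_mem' := by
    rintro _ _ ⟨Ω₁, h₁, horth₁, rfl⟩ ⟨Ω₂, h₂, horth₂, rfl⟩
    refine ⟨Ω₁ + Ω₂, isSkew_iff_mem_so.2 (add_mem (isSkew_iff_mem_so.1 h₁)
      (isSkew_iff_mem_so.1 h₂)), fun Ω' hΩ' htan => ?_, lie_add H Ω₁ Ω₂⟩
    rw [Matrix.add_mul, trace_add, horth₁ Ω' hΩ' htan, horth₂ Ω' hΩ' htan, add_zero]
  smul_mem' := by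
    rintro c _ ⟨Ω, hΩ, horth, rfl⟩
    refine ⟨c • Ω, hΩ.smul c, fun Ω' hΩ' htan => ?_, lie_smul c H Ω⟩
    rw [Matrix.smul_mul, trace_smul, horth Ω' hΩ' htan, smul_zero]

theorem mem_isoTangent_of_mem_critNormal (hX : X ∈ critNormal H) : X ∈ isoTangent H := by
  obtain ⟨Ω, hΩ, -, rfl⟩ := hX
  exact ⟨Ω, hΩ, rfl⟩

theorem mem_critNormal_iff (hH : H ∈ isoSym Λ) : X ∈ critNormal H ↔
    X ∈ isoTangent H ∧ ∀ Y ∈ critTangent H, normalMetric H X Y = 0 := by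
  constructor
  · rintro ⟨Ω, hΩ, horth, rfl⟩
    refine ⟨⟨Ω, hΩ, rfl⟩, fun Y hY => ?_⟩
    obtain ⟨Ω', hΩ', rfl⟩ := id hY.1
    rw [normalMetric_lie hH hΩ hΩ', horth Ω' hΩ' hY, neg_zero]
  · rintro ⟨⟨Ω, hΩ, rfl⟩, horth⟩
    refine ⟨Ω, hΩ, fun Ω' hΩ' htan => neg_eq_zero.1 ?_, rfl⟩
    rw [← normalMetric_lie hH hΩ hΩ', horth _ htan]

theorem normalSpace_eq_critNormal (hΛ : StronglyDisjoint Λ) (hH : H ∈ critSet Λ)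
    {S : Set (Mat Λ)} (hS : ∀ᶠ X in 𝓝 H, X ∈ S ↔ X ∈ critSet Λ) :
    normalSpace S H = critNormal H := by
  ext X
  rw [SetLike.mem_coe, mem_critNormal_iff hH.1, ← tangentSpaceAt_eq_critTangent hΛ hH hS]
  rfl

theorem eq_zero_of_mem_critNormal (hX : X ∈ critNormal H)
    (hcomm : ⁅diagonal H.diag, X⁆ = 0) (hdiag : X.diag = 0) : X = 0 := by
  obtain ⟨Ω, hΩ, horth, rfl⟩ := hX
  rw [hΩ.eq_zero_of_trace_mul_self (horth Ω hΩ ⟨⟨Ω, hΩ, rfl⟩, hcomm, hdiag⟩), lie_zero]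

end CritHessian

section EigenframeHessian

theorem IsEigenframe.lie_eq_zero_iff {m ι K : Type*} [Fintype m] [DecidableEq m] [Fintype ι]
    [DecidableEq ι] [Field K] {H A X : Matrix m m K} {Q : Matrix m ι K} {l a : ι → K}
    (h : IsEigenframe H Q l) (hA : A * Q = Q * diagonal a) :
    ⁅A, X⁆ = 0 ↔ ∀ i j, a i ≠ a j → (Qᵀ * X * Q) i j = 0 := by
  constructor
  · intro hcomm i j hij
    have hcoord := h.coord_lie hA X i j
    rw [hcomm, Matrix.mul_zero, Matrix.zero_mul, Matrix.zero_apply, zero_eq_mul] at hcoord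
    exact hcoord.resolve_left (sub_ne_zero.2 hij)
  · refine fun hcoord => h.ext_coord fun i j => ?_
    rw [h.coord_lie hA, Matrix.mul_zero, Matrix.zero_mul, Matrix.zero_apply]
    obtain hij | hij := eq_or_ne (a i) (a j)
    · rw [hij, sub_self, zero_mul]
    · rw [hcoord i j hij, mul_zero]

theorem mul_eq_zero_of_diagonal_mulVec_eq {m R : Type*} [Fintype m] [DecidableEq m] [CommRing R]
    [NoZeroDivisors R] {d u v : m → R} {a b : R} (hu : diagonal d *ᵥ u = a • u)
    (hv : diagonal d *ᵥ v = b • v) (hab : a ≠ b) (x : m) : u x * v x = 0 := by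
  have hux : d x * u x = a * u x := (mulVec_diagonal d u x).symm.trans (congrFun hu x)
  have hvx : d x * v x = b * v x := (mulVec_diagonal d v x).symm.trans (congrFun hv x)
  refine (mul_eq_zero.1 ?_).resolve_left (sub_ne_zero.2 hab)
  linear_combination u x * hvx - v x * hux

variable {Λ : Finset ℝ} {H X : Mat Λ} {ι : Type*} [Fintype ι] [DecidableEq ι]
  {Q : Matrix (Fin Λ.card) ι ℝ} {l m : ι → ℝ} {i j : ι}

namespace IsEigenframe

theorem lie_wedge_eq (h : IsEigenframe H Q l) (i j : ι) : ⁅H, wedge (Q.col i) (Q.col j)⁆ =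
    (l i - l j) • (vecMulVec (Q.col i) (Q.col j) + vecMulVec (Q.col j) (Q.col i)) :=
  lie_wedge h.transpose_eq_self (mul_eq_mul_diagonal_iff.1 h.mul_eq i)
    (mul_eq_mul_diagonal_iff.1 h.mul_eq j)

theorem diag_lie_wedge (h : IsEigenframe H Q l) (hm : diagonal H.diag * Q = Q * diagonal m)
    (hij : m i ≠ m j) : ⁅H, wedge (Q.col i) (Q.col j)⁆.diag = 0 := by
  ext x
  have hzero := mul_eq_zero_of_diagonal_mulVec_eq (mul_eq_mul_diagonal_iff.1 hm i)
    (mul_eq_mul_diagonal_iff.1 hm j) hij x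
  rw [h.lie_wedge_eq, diag_apply, Matrix.smul_apply, Matrix.add_apply, vecMulVec_apply,
    vecMulVec_apply, hzero, mul_comm, hzero, add_zero, smul_zero, Pi.zero_apply]

theorem hessian_lie_wedge (h : IsEigenframe H Q l) (hm : diagonal H.diag * Q = Q * diagonal m)
    (hH : H ∈ critSet Λ) (hX : X ∈ isoTangent H) (hij : m i ≠ m j) :
    hessian diagPotential H X ⁅H, wedge (Q.col i) (Q.col j)⁆ =
      -2 * (m i - m j) * (Qᵀ * X * Q) i j := by
  have hsymm : Xᵀ = X := by
    obtain ⟨Ω, hΩ, rfl⟩ := hX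
    exact hΩ.transpose_lie h.transpose_eq_self
  rw [hessian_lie_of_mem_critSet hH hX (isSkew_wedge _ _), h.diag_lie_wedge hm hij,
    dotProduct_zero, trace_mul_wedge_col, h.coord_lie hm, h.coord_lie hm,
    transpose_mul_mul_apply_comm hsymm Q j i]
  ring

theorem lie_wedge_mem_critNormal (h : IsEigenframe H Q l)
    (hm : diagonal H.diag * Q = Q * diagonal m) (hij : m i ≠ m j) :
    ⁅H, wedge (Q.col i) (Q.col j)⁆ ∈ critNormal H := by
  refine ⟨_, isSkew_wedge _ _, fun Ω _ htan => ?_, rfl⟩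
  have hcoord : ∀ {a b}, m a ≠ m b → (Qᵀ * Ω * Q) a b = 0 := fun {a b} hab => by
    have hzero := (h.lie_eq_zero_iff hm).1 htan.2.1 a b hab
    rw [h.coord_lie h.mul_eq, mul_eq_zero, sub_eq_zero] at hzero
    exact hzero.resolve_left fun hl => hab (congrArg m (h.injective hl))
  rw [trace_mul_comm, trace_mul_wedge_col, hcoord hij, hcoord hij.symm, sub_zero]

theorem coord_eq_zero_of_hessian_eq_zero (h : IsEigenframe H Q l)
    (hm : diagonal H.diag * Q = Q * diagonal m) (hH : H ∈ critSet Λ) (hX : X ∈ isoTangent H)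
    (hij : m i ≠ m j) (hzero : hessian diagPotential H X ⁅H, wedge (Q.col i) (Q.col j)⁆ = 0) :
    (Qᵀ * X * Q) i j = 0 := by
  rw [h.hessian_lie_wedge hm hH hX hij] at hzero
  exact (mul_eq_zero.1 hzero).resolve_left
    (mul_ne_zero (neg_ne_zero.2 two_ne_zero) (sub_ne_zero.2 hij))

end IsEigenframe

theorem nondegenerateOn_critNormal (hH : H ∈ critSet Λ) :
    NondegenerateOn (hessian diagPotential H) (critNormal H : Set (Mat Λ)) := by
  have hleft : ∀ X ∈ critNormal H,
      (∀ Y ∈ critNormal H, hessian diagPotential H X Y = 0) → X = 0 := fun X hX hzero => by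
    have hXtan := mem_isoTangent_of_mem_critNormal hX
    obtain ⟨Q, hQ⟩ := exists_isEigenframe hH.1
    obtain ⟨m, hm⟩ := hQ.exists_mul_eq_of_lie_eq_zero (by rw [← lie_skew, hH.2, neg_zero])
    have hcomm : ⁅diagonal H.diag, X⁆ = 0 := (hQ.lie_eq_zero_iff hm).2 fun i j hij =>
      hQ.coord_eq_zero_of_hessian_eq_zero hm hH hXtan hij
        (hzero _ (hQ.lie_wedge_mem_critNormal hm hij))
    have hself := hzero X hX
    rw [hessian_eq_dotProduct_diag hH hXtan hXtan hcomm] at hself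
    exact eq_zero_of_mem_critNormal hX hcomm (dotProduct_self_eq_zero.1 hself)
  exact ⟨hleft, fun Y hY hzero => hleft Y hY fun X hX => by
    rw [hessian_comm hH (mem_isoTangent_of_mem_critNormal hY)
      (mem_isoTangent_of_mem_critNormal hX), hzero X hX]⟩

theorem nondegenerateOn_normalSpace (hΛ : StronglyDisjoint Λ) (hH : H ∈ critSet Λ)
    {S : Set (Mat Λ)} (hS : ∀ᶠ X in 𝓝 H, X ∈ S ↔ X ∈ critSet Λ) :
    NondegenerateOn (hessian diagPotential H) (normalSpace S H) := by
  rw [normalSpace_eq_critNormal hΛ hH hS]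
  exact nondegenerateOn_critNormal hH

end EigenframeHessian

/-! ### The Morse-Bott property -/

section MorseBott

theorem norm_sq_eq_trace_transpose_mul {m n : Type*} [Fintype m] [Fintype n] (A : Matrix m n ℝ) :
    ‖A‖ ^ 2 = (Aᵀ * A).trace := by
  have hnonneg : 0 ≤ ∑ i, ∑ j, ‖A i j‖ ^ (2 : ℝ) :=
    Finset.sum_nonneg fun i _ => Finset.sum_nonneg fun j _ => Real.rpow_nonneg (norm_nonneg _) _
  rw [frobenius_norm_def, ← Real.sqrt_eq_rpow, Real.sq_sqrt hnonneg, Finset.sum_comm]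
  simp only [trace, diag_apply, Matrix.mul_apply, transpose_apply, Real.rpow_two,
    Real.norm_eq_abs, sq, abs_mul_abs_self]

variable {Λ : Finset ℝ} {H : Mat Λ}

theorem norm_sq_of_mem_isoSym (hH : H ∈ isoSym Λ) : ‖H‖ ^ 2 = ∑ i, Λ.orderEmbOfFin rfl i ^ 2 := by
  obtain ⟨Q, hQ⟩ := exists_isEigenframe hH
  have hsq : H * H = Q * diagonal (fun i => Λ.orderEmbOfFin rfl i ^ 2) * Qᵀ :=
    hQ.eq_conj <| by
      simp only [Matrix.mul_assoc, hQ.mul_eq]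
      simp only [← Matrix.mul_assoc, hQ.mul_eq]
      simp only [Matrix.mul_assoc, diagonal_mul_diagonal, sq]
  rw [norm_sq_eq_trace_transpose_mul, hH.1, hsq, trace_mul_cycle, hQ.transpose_mul_self,
    Matrix.one_mul, trace_diagonal]

theorem isCompact_critSet (Λ : Finset ℝ) : IsCompact (critSet Λ) := by
  refine Metric.isCompact_of_isClosed_isBounded ?_ ?_
  · have hset : critSet Λ = {H | Hᵀ = H} ∩ {H | charValues Λ H = 0} ∩
        {H | diagonal H.diag * H = H * diagonal H.diag} := by
      ext H
      simp only [critSet, mem_isoSym_iff_charValues, Ring.lie_def, sub_eq_zero, Set.mem_inter_iff,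
        Set.mem_ofPred_eq]
    have hdiag : Continuous fun H : Mat Λ => diagonal H.diag :=
      continuous_id.matrix_diag.matrix_diagonal
    rw [hset]
    exact ((isClosed_eq continuous_id.matrix_transpose continuous_id).inter
      (isClosed_eq contDiff_charValues.continuous continuous_const)).inter
      (isClosed_eq (hdiag.matrix_mul continuous_id) (continuous_id.matrix_mul hdiag))
  · refine isBounded_iff_forall_norm_le.2 ⟨√(∑ i, Λ.orderEmbOfFin rfl i ^ 2), fun H hH => ?_⟩
    rw [← norm_sq_of_mem_isoSym hH.1, Real.sqrt_sq (norm_nonneg H)]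

theorem isGradientAt_zero_iff (hH : H ∈ isoSym Λ) :
    IsGradientAt diagPotential H 0 ↔ H ∈ critSet Λ := by
  have hskew : IsSkew (0 : Mat Λ) := isSkew_iff_mem_so.2 (zero_mem _)
  have hmetric : ∀ Ω, IsSkew Ω → normalMetric H 0 ⁅H, Ω⁆ = 0 := fun Ω hΩ => by
    rw [← lie_zero H, normalMetric_lie hH hskew hΩ, Matrix.zero_mul, trace_zero, neg_zero]
  constructor
  · rintro ⟨-, hgrad⟩
    have hcomm := isSkew_lie_of_symm (diagonal_transpose H.diag) hH.1
    refine ⟨hH, hcomm.eq_zero_of_trace_mul_self ?_⟩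
    rw [← dotProduct_diag_lie, ← dirDeriv_diagPotential hH hcomm, ← hgrad _ ⟨_, hcomm, rfl⟩,
      hmetric _ hcomm]
  · rintro ⟨-, hcomm⟩
    refine ⟨⟨0, hskew, lie_zero H⟩, ?_⟩
    rintro _ ⟨Ω, hΩ, rfl⟩
    rw [hmetric Ω hΩ, dirDeriv_diagPotential hH hΩ, dotProduct_diag_lie, hcomm, Matrix.zero_mul,
      trace_zero]

theorem isLocallyConstant_diag (Λ : Finset ℝ) :
    IsLocallyConstant fun H : critSet Λ => (H : Mat Λ).diag :=
  (IsLocallyConstant.iff_eventually_eq _).2 fun H => by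
    filter_upwards [continuous_subtype_val.continuousAt.eventually (eventually_diag_eq H.1)]
      with X hX using hX X.2

theorem exists_isSubmanifold (hΛ : StronglyDisjoint Λ) {S : Set (Mat Λ)} {d : Fin Λ.card → ℝ}
    (hcrit : S ⊆ critSet Λ) (hS : ∀ H ∈ S, ∀ᶠ X in 𝓝 H, X ∈ S ↔ X ∈ critSet Λ)
    (hd : ∀ H ∈ S, H.diag = d) : ∃ k, IsSubmanifold S k :=
  ⟨Module.finrank ℝ (Mat Λ) - Module.finrank ℝ ((LinearMap.ker (blockSymm d)).prod
    ((⊤ : Submodule ℝ (Fin Λ.card → ℝ)).prod (LinearMap.ker (levelMean d)))),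
    .of_isCleanEquationAt fun H hH =>
      ⟨_, _, (isCleanEquationAt_critFun hΛ (hcrit hH)).congr_set (hS H hH), by
        rw [← (critFunDeriv H.diag H).toLinearMap.finrank_range_add_finrank_ker,
          ← hd H hH, ← range_critFunDeriv hΛ (hcrit hH)]
        exact (Nat.add_sub_cancel_left ..).symm⟩⟩

theorem locallyConnectedSpace_critSet (hΛ : StronglyDisjoint Λ) :
    LocallyConnectedSpace (critSet Λ) :=
  locallyConnectedSpace_of_slice_charts fun _ hH =>
    have ⟨Φ, hxs, _, _, hΦ, _⟩ := (isCleanEquationAt_critFun hΛ hH).exists_slice_chart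
    ⟨Φ, _, hxs, hΦ⟩

theorem eventually_mem_image_val_iff {V : Type*} [TopologicalSpace V] {S : Set V} {U : Set S}
    (hU : IsOpen U) {x : V} (hx : x ∈ Subtype.val '' U) :
    ∀ᶠ y in 𝓝 x, y ∈ Subtype.val '' U ↔ y ∈ S := by
  obtain ⟨W, hW, rfl⟩ := isOpen_induced_iff.1 hU
  rw [Subtype.image_preimage_coe] at hx ⊢
  filter_upwards [hW.mem_nhds hx.2] with y hy using and_iff_left hy

theorem isMorseBott_diagPotential (hΛ : StronglyDisjoint Λ) : IsMorseBott Λ diagPotential := by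
  have := locallyConnectedSpace_critSet hΛ
  have := isCompact_iff_compactSpace.1 (isCompact_critSet Λ)
  obtain ⟨m, ⟨e⟩⟩ := Finite.exists_equiv_fin (ConnectedComponents (critSet Λ))
  let comp (i : Fin m) : Set (critSet Λ) := ConnectedComponents.mk ⁻¹' {e.symm i}
  have hcomp (i : Fin m) : ∃ x, comp i = connectedComponent x := by
    obtain ⟨x, hx⟩ := ConnectedComponents.surjective_coe (e.symm i)
    exact ⟨x, by rw [← connectedComponents_preimage_singleton, hx]⟩
  refine ⟨⟨_, contDiff_diagPotential, fun _ _ => rfl⟩, m, fun i => Subtype.val '' comp i, ?_,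
    fun i j hij => ?_, fun i => ?_⟩
  · have hcover : ⋃ i, comp i = Set.univ := Set.eq_univ_of_forall fun x =>
      Set.mem_iUnion.2 ⟨e (ConnectedComponents.mk x), (e.symm_apply_apply _).symm⟩
    rw [← Set.image_iUnion, hcover, Set.image_univ, Subtype.range_coe]
    exact Set.ext fun H => ⟨fun hH => (isGradientAt_zero_iff hH.1).1 hH.2,
      fun hH => ⟨hH.1, (isGradientAt_zero_iff hH.1).2 hH⟩⟩
  · exact Set.disjoint_image_of_injective Subtype.val_injective
      ((Set.disjoint_singleton.2 (e.symm.injective.ne hij)).preimage _)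
  · obtain ⟨x, hx⟩ := hcomp i
    have hloc (H) (hH : H ∈ Subtype.val '' comp i) :
        ∀ᶠ X in 𝓝 H, X ∈ Subtype.val '' comp i ↔ X ∈ critSet Λ :=
      eventually_mem_image_val_iff (hx ▸ isOpen_connectedComponent) hH
    have hcrit : Subtype.val '' comp i ⊆ critSet Λ := Subtype.coe_image_subset _ _
    have hdiag : ∀ H ∈ Subtype.val '' comp i, H.diag = (x : Mat Λ).diag := by
      rw [hx]
      rintro _ ⟨y, hy, rfl⟩
      exact (isLocallyConstant_diag Λ).apply_eq_of_isPreconnected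
        isPreconnected_connectedComponent hy mem_connectedComponent
    have hconn : IsConnected (Subtype.val '' comp i) := by
      rw [hx]
      exact isConnected_connectedComponent.image _ continuous_subtype_val.continuousOn
    exact ⟨hconn, exists_isSubmanifold hΛ hcrit hloc hdiag,
      fun H hH => nondegenerateOn_normalSpace hΛ (hcrit hH) (hloc H hH)⟩

end MorseBott

/-! ### Permutations -/

section Permutation

/-- The points of the critical set with diagonal `d`; the sets `Pᵀ E_α P` are of this form. -/
def critSlice (Λ : Finset ℝ) (d : Fin Λ.card → ℝ) : Set (Mat Λ) :=
  {H | H ∈ critSet Λ ∧ H.diag = d}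

theorem eventually_mem_critSlice_iff {Λ : Finset ℝ} {d : Fin Λ.card → ℝ} {H : Mat Λ}
    (hd : H.diag = d) : ∀ᶠ X in 𝓝 H, X ∈ critSlice Λ d ↔ X ∈ critSet Λ := by
  filter_upwards [eventually_diag_eq H] with X hX
  exact ⟨And.left, fun hcrit => ⟨hcrit, (hX hcrit).trans hd⟩⟩

section Matrix

variable {n : ℕ} (σ : Equiv.Perm (Fin n)) (A B : Matrix (Fin n) (Fin n) ℝ)

theorem permConj_eq_reindexLieEquiv : permConj σ A = reindexLieEquiv (R := ℝ) σ A := by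
  rw [permConj, Equiv.Perm.permMatrix, ← PEquiv.toMatrix_symm, ← Equiv.toPEquiv_symm,
    PEquiv.toMatrix_toPEquiv_mul, PEquiv.mul_toMatrix_toPEquiv]
  rfl

theorem permConj_lie : permConj σ ⁅A, B⁆ = ⁅permConj σ A, permConj σ B⁆ := by
  simp only [permConj_eq_reindexLieEquiv, LieEquiv.map_lie]

theorem permConj_permConj_symm : permConj σ (permConj σ.symm A) = A := by
  simp only [permConj_eq_reindexLieEquiv]
  exact (reindexLieEquiv (R := ℝ) σ).apply_symm_apply A

theorem transpose_permConj : (permConj σ A)ᵀ = permConj σ Aᵀ := by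
  simp only [permConj_eq_reindexLieEquiv]
  rfl

theorem diag_permConj : (permConj σ A).diag = A.diag ∘ σ.symm := by
  rw [permConj_eq_reindexLieEquiv]
  rfl

theorem charpoly_permConj : (permConj σ A).charpoly = A.charpoly := by
  rw [permConj_eq_reindexLieEquiv]
  exact charpoly_reindex σ A

theorem permConj_diagonal (d : Fin n → ℝ) : permConj σ (diagonal d) = diagonal (d ∘ σ.symm) := by
  rw [permConj_eq_reindexLieEquiv]
  exact submatrix_diagonal_equiv d σ.symm

variable {A}

theorem IsSkew.permConj (hA : IsSkew A) : IsSkew (permConj σ A) := by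
  rw [IsSkew, transpose_permConj, hA]
  simp only [permConj_eq_reindexLieEquiv, map_neg]

theorem permConj_mem_isoTangent {X : Matrix (Fin n) (Fin n) ℝ} (hX : X ∈ isoTangent A) :
    permConj σ X ∈ isoTangent (permConj σ A) := by
  obtain ⟨Ω, hΩ, rfl⟩ := hX
  exact ⟨_, hΩ.permConj σ, (permConj_lie σ A Ω).symm⟩

end Matrix

variable {Λ : Finset ℝ} {H : Mat Λ} (σ : Equiv.Perm (Fin Λ.card))

theorem permConj_mem_isoSym (hH : H ∈ isoSym Λ) : permConj σ H ∈ isoSym Λ :=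
  ⟨by rw [transpose_permConj, hH.1], by rw [charpoly_permConj, hH.2]⟩

theorem hessian_permConj (hH : H ∈ isoSym Λ) {X Y : Mat Λ} (hX : X ∈ isoTangent H)
    (hY : Y ∈ isoTangent H) :
    hessian diagPotential (permConj σ H) (permConj σ X) (permConj σ Y) =
      hessian diagPotential H X Y := by
  obtain ⟨Ω₁, h₁, rfl⟩ := hX
  obtain ⟨Ω₂, h₂, rfl⟩ := hY
  rw [permConj_lie, permConj_lie, hessian_lie (permConj_mem_isoSym σ hH) (h₁.permConj σ)
    (h₂.permConj σ), hessian_lie hH h₁ h₂, lie_smul, lie_smul]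
  simp only [← permConj_lie, diag_smul, dotProduct_smul, diag_permConj,
    comp_equiv_dotProduct_comp_equiv]

variable {d : Fin Λ.card → ℝ}

theorem permConj_mem_critSlice (hH : H ∈ critSlice Λ d) :
    permConj σ H ∈ critSlice Λ (d ∘ σ.symm) := by
  obtain ⟨⟨hiso, hcomm⟩, rfl⟩ := hH
  refine ⟨⟨permConj_mem_isoSym σ hiso, ?_⟩, diag_permConj σ H⟩
  rw [diag_permConj, ← permConj_diagonal, ← permConj_lie, hcomm, permConj_eq_reindexLieEquiv,
    map_zero]

theorem image_permConj_critSlice : permConj σ '' critSlice Λ d = critSlice Λ (d ∘ σ.symm) := by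
  refine subset_antisymm (Set.image_subset_iff.2 fun H hH => permConj_mem_critSlice σ hH)
    fun H hH => ⟨permConj σ.symm H, ?_, permConj_permConj_symm σ H⟩
  simpa only [Function.comp_assoc, Equiv.symm_symm, Equiv.symm_comp_self, Function.comp_id]
    using permConj_mem_critSlice σ.symm hH

end Permutation

/-! ### Ordered partitions -/

theorem StronglyDisjoint.eq_of_mean_eq {Λ A B : Finset ℝ} (hΛ : StronglyDisjoint Λ) (hA : A ⊆ Λ)
    (hB : B ⊆ Λ) (hcard : A.card = B.card) (hmean : mean A = mean B) : A = B := by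
  by_contra hne
  have hcard_sdiff : (A \ B).card = (B \ A).card := Finset.card_sdiff_comm hcard
  have hAB : (A \ B).Nonempty := Finset.sdiff_nonempty.2 fun h =>
    hne (Finset.eq_of_subset_of_card_le h hcard.ge)
  have hBA : (B \ A).Nonempty := by rwa [← Finset.card_pos, ← hcard_sdiff, Finset.card_pos]
  refine hΛ _ _ (Finset.sdiff_subset.trans hA) (Finset.sdiff_subset.trans hB) hAB hBA
    disjoint_sdiff_sdiff ?_
  have hA0 : (A.card : ℝ) ≠ 0 :=
    Nat.cast_ne_zero.2 (hAB.mono Finset.sdiff_subset).card_pos.ne'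
  have hsum : ∑ x ∈ A, x = ∑ x ∈ B, x := by
    rwa [mean, mean, ← hcard, div_left_inj' hA0] at hmean
  have hsum_sdiff : ∑ x ∈ A \ B, x = ∑ x ∈ B \ A, x := by
    have hsplitA := Finset.sum_inter_add_sum_sdiff A B fun x => x
    have hsplitB := Finset.sum_inter_add_sum_sdiff B A fun x => x
    rw [Finset.inter_comm] at hsplitB
    linarith
  rw [mean, mean, hcard_sdiff, hsum_sdiff]

theorem StronglyDisjoint.subset {Λ Λ' : Finset ℝ} (hΛ : StronglyDisjoint Λ) (h : Λ' ⊆ Λ) :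
    StronglyDisjoint Λ' := fun A B hA hB => hΛ A B (hA.trans h) (hB.trans h)

namespace OrderedPartition

variable {Λ : Finset ℝ} (α : OrderedPartition Λ)

theorem part_subset (i : Fin α.k) : α.part i ⊆ Λ := fun x hx => by
  rw [← α.cover]
  exact Finset.mem_biUnion.2 ⟨i, Finset.mem_univ i, hx⟩

theorem mean_part_injective (hΛ : StronglyDisjoint Λ) :
    Function.Injective fun i => mean (α.part i) := fun i j h => by
  by_contra hne
  exact hΛ _ _ (α.part_subset i) (α.part_subset j) (α.nonempty i) (α.nonempty j)
    (α.disjoint hne) h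

theorem prod_part : ∏ i, ∏ l ∈ α.part i, (X - C l : ℝ[X]) = ∏ l ∈ Λ, (X - C l) := by
  conv_rhs => rw [← α.cover]
  rw [Finset.prod_biUnion]
  exact fun i _ j _ hij => α.disjoint hij

/-- The number of the block that contains the row `x`. -/
def blockIndex (x : Fin Λ.card) : Fin α.k := (α.blockEquiv.symm x).1

theorem blockIndex_blockEquiv (x : Σ i, Fin (α.size i)) : α.blockIndex (α.blockEquiv x) = x.1 := by
  rw [blockIndex, Equiv.symm_apply_apply]

theorem blockIndex_surjective : Function.Surjective α.blockIndex := fun i =>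
  ⟨α.blockEquiv ⟨i, 0, (α.nonempty i).card_pos⟩, α.blockIndex_blockEquiv _⟩

/-- The rows of the `i`-th block, numbered from zero. -/
def blockIndexEquiv (i : Fin α.k) : {x // α.blockIndex x = i} ≃ Fin (α.size i) :=
  (α.blockEquiv.symm.subtypeEquiv fun _ => Iff.rfl).trans (Equiv.sigmaSubtype i)

/-- The vector in `ℝⁿ` with blocks `w 0, …, w (k - 1)`. -/
def concat (w : ∀ i, Fin (α.size i) → ℝ) (x : Fin Λ.card) : ℝ :=
  w (α.blockEquiv.symm x).1 (α.blockEquiv.symm x).2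

/-- The common diagonal of the matrices in `E_α`. -/
noncomputable def level : Fin Λ.card → ℝ := α.concat fun i _ => mean (α.part i)

section Concat

variable {α}

theorem concat_blockEquiv (w : ∀ i, Fin (α.size i) → ℝ) (x : Σ i, Fin (α.size i)) :
    α.concat w (α.blockEquiv x) = w x.1 x.2 := by
  rw [concat, Equiv.symm_apply_apply]

theorem concat_injective : Function.Injective α.concat := fun w w' h => by
  ext i a
  rw [← concat_blockEquiv w ⟨i, a⟩, h, concat_blockEquiv]

theorem concat_dotProduct (w : ∀ i, Fin (α.size i) → ℝ) (z : Fin Λ.card → ℝ) :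
    α.concat w ⬝ᵥ z = ∑ i, w i ⬝ᵥ fun a => z (α.blockEquiv ⟨i, a⟩) := by
  simp only [dotProduct]
  rw [← Equiv.sum_comp α.blockEquiv, Fintype.sum_sigma]
  simp only [concat_blockEquiv]

theorem diag_blockEquiv (B : α.Blocks) (x y : Σ i, Fin (α.size i)) :
    α.diag B (α.blockEquiv x) (α.blockEquiv y) = blockDiagonal' B x y := by
  rw [diag, reindex_apply, submatrix_apply, Equiv.symm_apply_apply, Equiv.symm_apply_apply]

theorem diag_apply_eq_zero (B : α.Blocks) {x y : Fin Λ.card}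
    (hxy : α.blockIndex x ≠ α.blockIndex y) : α.diag B x y = 0 :=
  blockDiagonal'_apply_ne B _ _ hxy

theorem exists_diag_eq {H : Mat Λ} (hH : ∀ x y, α.blockIndex x ≠ α.blockIndex y → H x y = 0) :
    ∃ B, α.diag B = H := by
  let B : α.Blocks := (H.submatrix α.blockEquiv α.blockEquiv).blockDiag'
  refine ⟨B, ?_⟩
  rw [diag, ← Equiv.eq_symm_apply]
  ext ⟨i, a⟩ ⟨j, b⟩
  obtain rfl | hij := eq_or_ne i j
  · exact blockDiagonal'_apply_eq B i a b
  · rw [blockDiagonal'_apply_ne _ _ _ hij]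
    refine (hH _ _ ?_).symm
    rwa [blockIndex_blockEquiv, blockIndex_blockEquiv]

theorem diag_injective : Function.Injective α.diag :=
  (reindex α.blockEquiv α.blockEquiv).injective.comp blockDiagonal'_injective

theorem transpose_diag (B : α.Blocks) : (α.diag B)ᵀ = α.diag fun i => (B i)ᵀ := by
  rw [diag, transpose_reindex, blockDiagonal'_transpose, diag]

theorem diag_lie (B B' : α.Blocks) : ⁅α.diag B, α.diag B'⁆ = α.diag fun i => ⁅B i, B' i⁆ := by
  simp only [Ring.lie_def, diag, reindex_apply, submatrix_mul_equiv, ← blockDiagonal'_mul]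
  rw [← Pi.sub_def, blockDiagonal'_sub]
  rfl

theorem diag_diag (B : α.Blocks) : (α.diag B).diag = α.concat fun i => (B i).diag := by
  ext x
  exact blockDiagonal'_apply_eq B _ _ _

theorem diagonal_concat (w : ∀ i, Fin (α.size i) → ℝ) :
    diagonal (α.concat w) = α.diag fun i => diagonal (w i) := by
  rw [diag, blockDiagonal'_diagonal, reindex_apply, submatrix_diagonal_equiv]
  rfl

theorem diag_mulVec_concat (B : α.Blocks) (w : ∀ i, Fin (α.size i) → ℝ) :
    α.diag B *ᵥ α.concat w = α.concat fun i => B i *ᵥ w i := by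
  ext x
  obtain ⟨⟨i, a⟩, rfl⟩ := α.blockEquiv.surjective x
  rw [mulVec, dotProduct_comm, concat_dotProduct, concat_blockEquiv, Fintype.sum_eq_single i]
  · simp only [diag_blockEquiv, blockDiagonal'_apply_eq]
    exact dotProduct_comm _ _
  · intro j hj
    simp only [diag_blockEquiv, blockDiagonal'_apply_ne B _ _ hj.symm]
    exact dotProduct_zero _

theorem charpoly_toSquareBlock_diag (B : α.Blocks) (i : Fin α.k) :
    ((α.diag B).toSquareBlock α.blockIndex i).charpoly = (B i).charpoly := by
  rw [← Matrix.charpoly_reindex (α.blockIndexEquiv i)]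
  congr 1
  ext a b
  change α.diag B (α.blockEquiv ⟨i, a⟩) (α.blockEquiv ⟨i, b⟩) = B i a b
  rw [diag_blockEquiv, blockDiagonal'_apply_eq]

theorem charpoly_diag (B : α.Blocks) : (α.diag B).charpoly = ∏ i, (B i).charpoly := by
  have hblock : (α.diag B).BlockTriangular α.blockIndex := fun x y hxy =>
    diag_apply_eq_zero B hxy.ne'
  rw [hblock.charpoly, Finset.image_univ_of_surjective α.blockIndex_surjective]
  exact Finset.prod_congr rfl fun i _ => charpoly_toSquareBlock_diag B i

end Concat

section CriticalManifold

variable {α} {B : α.Blocks}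

theorem IsCritical.diag_diag_eq_level (hB : α.IsCritical B) : (α.diag B).diag = α.level := by
  rw [diag_diag]
  exact congrArg α.concat (funext fun i => funext (hB i).2)

theorem IsCritical.block_mem_critSet (hB : α.IsCritical B) (i : Fin α.k) :
    B i ∈ critSet (α.part i) :=
  ⟨(hB i).1, diagonal_lie_eq_zero_iff.2 fun a b hab =>
    absurd (((hB i).2 a).trans ((hB i).2 b).symm) hab⟩

theorem IsCritical.diag_mem_critSlice (hB : α.IsCritical B) : α.diag B ∈ critSlice Λ α.level := by
  refine ⟨⟨⟨?_, ?_⟩, diagonal_lie_eq_zero_iff.2 fun x y hxy => diag_apply_eq_zero B ?_⟩,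
    hB.diag_diag_eq_level⟩
  · rw [transpose_diag]
    exact congrArg α.diag (funext fun i => (hB i).1.1)
  · rw [charpoly_diag, ← α.prod_part]
    exact Finset.prod_congr rfl fun i _ => (hB i).1.2
  · rw [hB.diag_diag_eq_level] at hxy
    exact fun h => hxy (congrArg (fun i => mean (α.part i)) h)

theorem charpoly_block_eq (hΛ : StronglyDisjoint Λ)
    (hcharpoly : (α.diag B).charpoly = ∏ l ∈ Λ, (X - C l))
    (hdiag : (α.diag B).diag = α.level) (i : Fin α.k) :
    (B i).charpoly = ∏ l ∈ α.part i, (X - C l) := by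
  obtain ⟨x, rfl⟩ := α.blockIndex_surjective i
  have hblock : ∀ x y, α.blockIndex x ≠ α.blockIndex y → α.diag B x y = 0 := fun _ _ =>
    diag_apply_eq_zero B
  have hlevel : levelMean α.blockIndex α.level = α.level := levelMean_eq_self_iff.2
    fun x y hxy => congrArg (fun i => mean (α.part i)) hxy
  have hcard : (blockSpectrum (α.diag B) α.blockIndex (α.blockIndex x)).card =
      α.size (α.blockIndex x) := by
    rw [card_blockSpectrum hcharpoly hblock, ← Fintype.card_subtype,
      Fintype.card_congr (α.blockIndexEquiv _), Fintype.card_fin]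
  have hmean : mean (blockSpectrum (α.diag B) α.blockIndex (α.blockIndex x)) =
      mean (α.part (α.blockIndex x)) := by
    rw [mean_blockSpectrum hcharpoly hblock, hdiag, hlevel]
    rfl
  rw [← charpoly_toSquareBlock_diag, charpoly_toSquareBlock hcharpoly hblock,
    hΛ.eq_of_mean_eq (blockSpectrum_subset hcharpoly hblock x) (α.part_subset _) hcard hmean]

variable (α)

theorem E_eq_critSlice (hΛ : StronglyDisjoint Λ) : α.E = critSlice Λ α.level := by
  refine subset_antisymm (fun _ ⟨_, hB, h⟩ => h ▸ hB.diag_mem_critSlice) ?_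
  rintro H ⟨⟨⟨hsymm, hcharpoly⟩, hcrit⟩, hdiag⟩
  rw [hdiag, diagonal_lie_eq_zero_iff] at hcrit
  obtain ⟨B, rfl⟩ := exists_diag_eq fun x y hxy =>
    hcrit x y ((α.mean_part_injective hΛ).ne hxy)
  have hblock_symm : (fun i => (B i)ᵀ) = B :=
    diag_injective ((transpose_diag B).symm.trans hsymm)
  have hblock_diag : (fun i => (B i).diag) = fun i _ => mean (α.part i) :=
    concat_injective ((diag_diag B).symm.trans hdiag)
  exact ⟨B, fun i => ⟨⟨congrFun hblock_symm i, charpoly_block_eq hΛ hcharpoly hdiag i⟩,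
    congrFun (congrFun hblock_diag i)⟩, rfl⟩

end CriticalManifold

end OrderedPartition

/-! ### The basis of the normal space -/

section OrthogonalFamily

theorem eq_zero_of_dotProduct_eq_zero {κ m : Type*} [Fintype κ] [Fintype m] {w : κ → m → ℝ}
    {z : m → ℝ} (horth : ∀ k k', k ≠ k' → w k ⬝ᵥ w k' = 0) (hself : ∀ k, w k ⬝ᵥ w k ≠ 0)
    (hcard : Fintype.card κ = Fintype.card m) (hz : ∀ k, w k ⬝ᵥ z = 0) : z = 0 := by
  have hli : LinearIndependent ℝ w :=
    linearIndependent_of_biorthogonal (φ := fun k => dotProductBilin ℝ ℝ (w k)) horth hself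
  have hspan : Submodule.span ℝ (Set.range w) = ⊤ :=
    hli.span_eq_top_of_card_eq_finrank' (by rw [hcard, Module.finrank_pi])
  have hmap : (dotProductBilin ℝ ℝ).flip z = (0 : (m → ℝ) →ₗ[ℝ] ℝ) :=
    LinearMap.ext_on_range hspan hz
  exact dotProduct_self_eq_zero.1 (LinearMap.congr_fun hmap z)

theorem eq_zero_of_orthogonal_hyperplane_basis {m : ℕ} (hm : 0 < m) {u : Fin (m - 1) → Fin m → ℝ}
    (hsum : ∀ j, ∑ a, u j a = 0) (horth : ∀ j j', u j ⬝ᵥ u j' = if j = j' then 1 else 0)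
    {z : Fin m → ℝ} (hz : ∑ a, z a = 0) (hzu : ∀ j, u j ⬝ᵥ z = 0) : z = 0 := by
  refine eq_zero_of_dotProduct_eq_zero (w := fun o : Option (Fin (m - 1)) => o.elim 1 u)
    ?_ ?_ ?_ ?_
  · rintro (_ | j) (_ | j') hne
    · exact absurd rfl hne
    · exact (one_dotProduct _).trans (hsum j')
    · exact (dotProduct_one _).trans (hsum j)
    · exact (horth j j').trans (if_neg fun h => hne (congrArg some h))
  · rintro (_ | j)
    · simpa using hm.ne'
    · exact (horth j j).trans_ne (by simp)
  · rw [Fintype.card_option, Fintype.card_fin, Fintype.card_fin, Nat.sub_add_cancel hm]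
  · rintro (_ | j)
    · exact (one_dotProduct _).trans hz
    · exact hzu j

end OrthogonalFamily

section CritNormal

variable {Λ : Finset ℝ} {H : Mat Λ}

theorem linearIndependent_and_span_eq_critNormal (hH : H ∈ critSet Λ) {κ : Type*} [Finite κ]
    {s : κ → Mat Λ} (hs : ∀ k, s k ∈ critNormal H)
    (horth : ∀ k k', k ≠ k' → hessian diagPotential H (s k) (s k') = 0)
    (hself : ∀ k, hessian diagPotential H (s k) (s k) ≠ 0)
    (hcompl : ∀ X ∈ critNormal H, (∀ k, hessian diagPotential H X (s k) = 0) → X = 0) :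
    LinearIndependent ℝ s ∧ Submodule.span ℝ (Set.range s) = critNormal H := by
  choose M hM using fun k =>
    exists_hessian_eq_trace_mul hH (mem_isoTangent_of_mem_critNormal (hs k))
  let φ k : Mat Λ →ₗ[ℝ] ℝ := traceLinearMap _ ℝ ℝ ∘ₗ LinearMap.mulRight ℝ (M k)
  have hφ : ∀ k, ∀ X ∈ critNormal H, φ k X = hessian diagPotential H X (s k) := fun k X hX =>
    (hM k X (mem_isoTangent_of_mem_critNormal hX)).symm
  have hne : ∀ k k', k ≠ k' → φ k (s k') = 0 := fun k k' hkk' =>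
    (hφ k _ (hs k')).trans (horth k' k hkk'.symm)
  have hφself : ∀ k, φ k (s k) ≠ 0 := fun k => (hφ k _ (hs k)).trans_ne (hself k)
  exact ⟨linearIndependent_of_biorthogonal hne hφself,
    span_range_eq_of_biorthogonal hne hφself hs fun X hX hzero =>
      hcompl X hX fun k => (hφ k X hX).symm.trans (hzero k)⟩

theorem lie_diagonal_lie_mem_critNormal (hH : Hᵀ = H) (f : Fin Λ.card → ℝ) :
    ⁅H, ⁅diagonal f, H⁆⁆ ∈ critNormal H :=
  ⟨_, isSkew_lie_of_symm (diagonal_transpose f) hH, fun Ω _ htan => by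
    rw [← dotProduct_diag_lie, htan.2.2, dotProduct_zero], rfl⟩

theorem diagonal_lie_lie_diagonal_lie (hH : ⁅diagonal H.diag, H⁆ = 0) (f : Fin Λ.card → ℝ) :
    ⁅diagonal H.diag, ⁅H, ⁅diagonal f, H⁆⁆⁆ = 0 := by
  have hf : ⁅diagonal H.diag, diagonal f⁆ = 0 :=
    diagonal_lie_eq_zero_iff.2 fun i j hij => diagonal_apply_ne _ (ne_of_apply_ne _ hij)
  rw [leibniz_lie (diagonal H.diag) H, leibniz_lie (diagonal H.diag) (diagonal f), hf, hH]
  simp only [zero_lie, lie_zero, add_zero]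

end CritNormal

section WedgeCoordinates

variable {m ι K : Type*} [Fintype m] [DecidableEq m] [Fintype ι] [DecidableEq ι] [Field K]
  {H : Matrix m m K} {Q : Matrix m ι K} {l : ι → K}

theorem IsEigenframe.coord_vecMulVec_col (h : IsEigenframe H Q l) (i j : ι) :
    Qᵀ * vecMulVec (Q.col i) (Q.col j) * Q = Matrix.single i j 1 := by
  have hcol : ∀ i, Qᵀ *ᵥ Q.col i = Pi.single i 1 := fun i => by
    rw [← mulVec_single_one, mulVec_mulVec, h.transpose_mul_self, one_mulVec]
  rw [mul_vecMulVec, vecMulVec_mul, ← mulVec_transpose, hcol, hcol,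
    single_eq_single_vecMulVec_single]

theorem IsEigenframe.coord_lie_wedge (h : IsEigenframe H Q l) (i j i' j' : ι) :
    (Qᵀ * ⁅H, wedge (Q.col i) (Q.col j)⁆ * Q) i' j' = (l i' - l j') *
      ((if i = i' ∧ j = j' then 1 else 0) - if j = i' ∧ i = j' then 1 else 0) := by
  rw [h.coord_lie h.mul_eq, wedge, Matrix.mul_sub, Matrix.sub_mul, h.coord_vecMulVec_col,
    h.coord_vecMulVec_col, Matrix.sub_apply, single_apply, single_apply]

end WedgeCoordinates

namespace OrderedPartition

variable {Λ : Finset ℝ} {α : OrderedPartition Λ}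

section Extend

theorem extend_smul (p : Fin α.k) (c : ℝ) (w : Fin (α.size p) → ℝ) :
    α.extend p (c • w) = c • α.extend p w := by
  change α.concat (Pi.single p (c • w)) = _
  rw [Pi.single_smul]
  rfl

theorem extend_dotProduct (p : Fin α.k) (w : Fin (α.size p) → ℝ) (z : Fin Λ.card → ℝ) :
    α.extend p w ⬝ᵥ z = w ⬝ᵥ fun a => z (α.blockEquiv ⟨p, a⟩) := by
  refine (concat_dotProduct (Pi.single p w) z).trans ?_
  rw [Fintype.sum_eq_single p fun q hq => by rw [Pi.single_eq_of_ne hq, zero_dotProduct],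
    Pi.single_eq_same]

theorem extend_dotProduct_extend (p q : Fin α.k) (w : Fin (α.size p) → ℝ)
    (w' : Fin (α.size q) → ℝ) :
    α.extend p w ⬝ᵥ α.extend q w' = w ⬝ᵥ (Pi.single q w' : ∀ i, Fin (α.size i) → ℝ) p := by
  rw [extend_dotProduct]
  exact congrArg (w ⬝ᵥ ·) (funext fun a => concat_blockEquiv (Pi.single q w') ⟨p, a⟩)

theorem diag_mulVec_extend (B : α.Blocks) (p : Fin α.k) (w : Fin (α.size p) → ℝ) :
    α.diag B *ᵥ α.extend p w = α.extend p (B p *ᵥ w) :=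
  (diag_mulVec_concat B (Pi.single p w)).trans <| congrArg α.concat <| funext fun i =>
    Pi.apply_single (fun i => (B i *ᵥ ·)) (fun i => mulVec_zero (B i)) p w i

theorem diag_diag_single (p : Fin α.k) (M : Matrix (Fin (α.size p)) (Fin (α.size p)) ℝ) :
    (α.diag (Pi.single p M)).diag = α.extend p M.diag :=
  (diag_diag (Pi.single p M)).trans <| congrArg α.concat <| funext fun i =>
    Pi.apply_single (fun i (M : Matrix (Fin (α.size i)) (Fin (α.size i)) ℝ) => M.diag)
      (fun _ => Matrix.diag_zero) p M i

theorem diag_lie_diag_single (B : α.Blocks) (p : Fin α.k)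
    (M : Matrix (Fin (α.size p)) (Fin (α.size p)) ℝ) :
    ⁅α.diag B, α.diag (Pi.single p M)⁆ = α.diag (Pi.single p ⁅B p, M⁆) :=
  (diag_lie B (Pi.single p M)).trans <| congrArg α.diag <| funext fun i =>
    Pi.apply_single (fun i (M : Matrix (Fin (α.size i)) (Fin (α.size i)) ℝ) => ⁅B i, M⁆)
      (fun i => lie_zero (B i)) p M i

theorem diagonal_extend_lie_diag (B : α.Blocks) (p : Fin α.k) (e : Fin (α.size p) → ℝ) :
    ⁅diagonal (α.extend p e), α.diag B⁆ = α.diag (Pi.single p ⁅diagonal e, B p⁆) := by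
  change ⁅diagonal (α.concat (Pi.single p e)), α.diag B⁆ = _
  rw [diagonal_concat, diag_lie]
  refine congrArg α.diag <| funext fun i =>
    Pi.apply_single (fun i (e : Fin (α.size i) → ℝ) => ⁅diagonal e, B i⁆) (fun i => ?_) p e i
  rw [diagonal_zero', zero_lie]

end Extend

section Frame

variable {B : α.Blocks} {v : ∀ i : Fin α.k, Fin (α.size i) → Fin (α.size i) → ℝ}

variable (α) in
theorem eig_injective : Function.Injective fun x : Σ i, Fin (α.size i) => α.eig x.1 x.2 := by
  rintro ⟨i, a⟩ ⟨j, b⟩ (h : α.eig i a = α.eig j b)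
  have hmem : ∀ i a, α.eig i a ∈ α.part i := fun i => Finset.orderEmbOfFin_mem (α.part i) rfl
  obtain rfl : i = j := by
    by_contra hne
    exact Finset.disjoint_left.1 (α.disjoint hne) (hmem i a) (h ▸ hmem j b)
  exact congrArg _ (((α.part i).orderEmbOfFin rfl).injective h)

/-- The matrix whose columns are the vectors `v_{ia}`, extended by zero to `ℝⁿ`. -/
def frame (v : ∀ i : Fin α.k, Fin (α.size i) → Fin (α.size i) → ℝ) :
    Matrix (Fin Λ.card) (Σ i : Fin α.k, Fin (α.size i)) ℝ :=
  (Matrix.of fun x => α.extend x.1 (v x.1 x.2))ᵀ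

theorem isEigenframe_frame (hB : α.IsCritical B) (hv : α.IsUnitEigen B v) :
    IsEigenframe (α.diag B) (α.frame v) fun x => α.eig x.1 x.2 := by
  refine .of_unit_eigenvectors hB.diag_mem_critSlice.1.1.1 α.eig_injective
    (mul_eq_mul_diagonal_iff.2 fun x => ?_) (fun x => ?_) (by simp [α.sum_size])
  · change α.diag B *ᵥ α.extend x.1 (v x.1 x.2) = _ • α.extend x.1 (v x.1 x.2)
    rw [diag_mulVec_extend, (hv x.1 x.2).1, extend_smul]
  · change α.extend x.1 (v x.1 x.2) ⬝ᵥ α.extend x.1 (v x.1 x.2) = 1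
    rw [extend_dotProduct_extend, Pi.single_eq_same, (hv x.1 x.2).2]

theorem IsCritical.diagonal_diag_mul_frame (hB : α.IsCritical B)
    (v : ∀ i : Fin α.k, Fin (α.size i) → Fin (α.size i) → ℝ) :
    diagonal (α.diag B).diag * α.frame v =
      α.frame v * diagonal fun x => mean (α.part x.1) := by
  refine mul_eq_mul_diagonal_iff.2 fun x => ?_
  change _ *ᵥ α.extend x.1 (v x.1 x.2) = _ • α.extend x.1 (v x.1 x.2)
  rw [hB.diag_diag_eq_level, level, diagonal_concat, diag_mulVec_extend, ← extend_smul]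
  exact congrArg (α.extend x.1) (funext fun a => mulVec_diagonal _ _ a)

end Frame

section OffVec

variable {B : α.Blocks} {v : ∀ i : Fin α.k, Fin (α.size i) → Fin (α.size i) → ℝ}
  {x x' : α.OffIndex} {X : Mat Λ}

/-- The index `(p, i)` of the eigenvector `v_{pi}` in `N_{pq,ij}`. -/
def offLeft (x : α.OffIndex) : Σ i, Fin (α.size i) := ⟨x.1.1.1, x.2.1⟩

/-- The index `(q, j)` of the eigenvector `v_{qj}` in `N_{pq,ij}`. -/
def offRight (x : α.OffIndex) : Σ i, Fin (α.size i) := ⟨x.1.1.2, x.2.2⟩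

theorem offIndex_ext_iff : x = x' ↔ offLeft x = offLeft x' ∧ offRight x = offRight x' := by
  refine ⟨fun h => h ▸ ⟨rfl, rfl⟩, fun ⟨hleft, hright⟩ => ?_⟩
  obtain ⟨⟨⟨p, q⟩, hpq⟩, a, b⟩ := x
  obtain ⟨⟨⟨p', q'⟩, hpq'⟩, a', b'⟩ := x'
  cases hleft
  cases hright
  rfl

theorem not_offRight_eq_offLeft_and :
    ¬(offRight x = offLeft x' ∧ offLeft x = offRight x') := fun ⟨h, h'⟩ => by
  have hlt : (offLeft x').1 < (offRight x').1 := x'.1.2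
  rw [← h, ← h'] at hlt
  exact lt_asymm x.1.2 hlt

theorem mean_offLeft_ne (hΛ : StronglyDisjoint Λ) (x : α.OffIndex) :
    mean (α.part (offLeft x).1) ≠ mean (α.part (offRight x).1) :=
  (α.mean_part_injective hΛ).ne x.1.2.ne

theorem offVec_eq_lie_wedge (hB : α.IsCritical B) (hv : α.IsUnitEigen B v) (x : α.OffIndex) :
    α.offVec v x =
      ⁅α.diag B, wedge ((α.frame v).col (offLeft x)) ((α.frame v).col (offRight x))⁆ :=
  ((isEigenframe_frame hB hv).lie_wedge_eq (offLeft x) (offRight x)).symm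

theorem offVec_mem_critNormal (hΛ : StronglyDisjoint Λ) (hB : α.IsCritical B)
    (hv : α.IsUnitEigen B v) (x : α.OffIndex) : α.offVec v x ∈ critNormal (α.diag B) := by
  rw [offVec_eq_lie_wedge hB hv]
  exact (isEigenframe_frame hB hv).lie_wedge_mem_critNormal (hB.diagonal_diag_mul_frame v)
    (mean_offLeft_ne hΛ x)

theorem diag_offVec (hΛ : StronglyDisjoint Λ) (hB : α.IsCritical B) (hv : α.IsUnitEigen B v)
    (x : α.OffIndex) : (α.offVec v x).diag = 0 := by
  rw [offVec_eq_lie_wedge hB hv]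
  exact (isEigenframe_frame hB hv).diag_lie_wedge (hB.diagonal_diag_mul_frame v)
    (mean_offLeft_ne hΛ x)

theorem hessian_offVec (hΛ : StronglyDisjoint Λ) (hB : α.IsCritical B) (hv : α.IsUnitEigen B v)
    (hX : X ∈ isoTangent (α.diag B)) (x : α.OffIndex) :
    hessian diagPotential (α.diag B) X (α.offVec v x) =
      -2 * (mean (α.part (offLeft x).1) - mean (α.part (offRight x).1)) *
        ((α.frame v)ᵀ * X * α.frame v) (offLeft x) (offRight x) := by
  rw [offVec_eq_lie_wedge hB hv]
  exact (isEigenframe_frame hB hv).hessian_lie_wedge (hB.diagonal_diag_mul_frame v)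
    hB.diag_mem_critSlice.1 hX (mean_offLeft_ne hΛ x)

theorem coord_offVec (hB : α.IsCritical B) (hv : α.IsUnitEigen B v) (x x' : α.OffIndex) :
    ((α.frame v)ᵀ * α.offVec v x * α.frame v) (offLeft x') (offRight x') =
      if x = x' then α.eig x.1.1.1 x.2.1 - α.eig x.1.1.2 x.2.2 else 0 := by
  rw [offVec_eq_lie_wedge hB hv, (isEigenframe_frame hB hv).coord_lie_wedge,
    if_neg not_offRight_eq_offLeft_and, sub_zero]
  simp only [← offIndex_ext_iff, mul_ite, mul_one, mul_zero]
  exact ite_congr rfl (fun h => h ▸ rfl) fun _ => rfl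

theorem hessian_offVec_offVec (hΛ : StronglyDisjoint Λ) (hB : α.IsCritical B)
    (hv : α.IsUnitEigen B v) (x x' : α.OffIndex) :
    hessian diagPotential (α.diag B) (α.offVec v x) (α.offVec v x') =
      if x = x' then -2 * (α.eig x.1.1.1 x.2.1 - α.eig x.1.1.2 x.2.2) *
        (mean (α.part x.1.1.1) - mean (α.part x.1.1.2)) else 0 := by
  have htan := mem_isoTangent_of_mem_critNormal (offVec_mem_critNormal hΛ hB hv x)
  rw [hessian_offVec hΛ hB hv htan, coord_offVec hB hv, mul_ite, mul_zero]
  refine ite_congr rfl (fun h => ?_) fun _ => rfl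
  rw [← h, offLeft, offRight]
  ring

theorem hessian_offVec_self_ne_zero (hΛ : StronglyDisjoint Λ) (hB : α.IsCritical B)
    (hv : α.IsUnitEigen B v) (x : α.OffIndex) :
    hessian diagPotential (α.diag B) (α.offVec v x) (α.offVec v x) ≠ 0 := by
  have heig : α.eig x.1.1.1 x.2.1 ≠ α.eig x.1.1.2 x.2.2 :=
    α.eig_injective.ne (a₁ := offLeft x) (a₂ := offRight x) fun h =>
      x.1.2.ne (congrArg Sigma.fst h)
  rw [hessian_offVec_offVec hΛ hB hv, if_pos rfl]
  exact mul_ne_zero (mul_ne_zero (neg_ne_zero.2 two_ne_zero) (sub_ne_zero.2 heig))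
    (sub_ne_zero.2 (mean_offLeft_ne hΛ x))

theorem diagonal_diag_lie_eq_zero (hΛ : StronglyDisjoint Λ) (hB : α.IsCritical B)
    (hv : α.IsUnitEigen B v) (hX : X ∈ isoTangent (α.diag B))
    (hzero : ∀ x, hessian diagPotential (α.diag B) X (α.offVec v x) = 0) :
    ⁅diagonal (α.diag B).diag, X⁆ = 0 := by
  have hframe := isEigenframe_frame hB hv
  have hsymm : Xᵀ = X := by
    obtain ⟨Ω, hΩ, rfl⟩ := hX
    exact hΩ.transpose_lie hframe.transpose_eq_self
  have hcoord (x : α.OffIndex) :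
      ((α.frame v)ᵀ * X * α.frame v) (offLeft x) (offRight x) = 0 :=
    hframe.coord_eq_zero_of_hessian_eq_zero (hB.diagonal_diag_mul_frame v)
      hB.diag_mem_critSlice.1 hX (mean_offLeft_ne hΛ x) (offVec_eq_lie_wedge hB hv x ▸ hzero x)
  refine (hframe.lie_eq_zero_iff (hB.diagonal_diag_mul_frame v)).2 ?_
  rintro ⟨p, a⟩ ⟨q, b⟩ hpq
  rcases lt_trichotomy p q with h | rfl | h
  · exact hcoord ⟨⟨(p, q), h⟩, a, b⟩
  · exact absurd rfl hpq
  · rw [transpose_mul_mul_apply_comm hsymm]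
    exact hcoord ⟨⟨(q, p), h⟩, b, a⟩

end OffVec

section DiagVec

variable {B : α.Blocks} {u : ∀ i : Fin α.k, Fin (α.size i - 1) → Fin (α.size i) → ℝ}
  {Ω : ∀ i : Fin α.k, Fin (α.size i - 1) → Matrix (Fin (α.size i)) (Fin (α.size i)) ℝ}
  {X : Mat Λ}

/-- The diagonal of `[B_p, Ω_{p,t}]` is `u_{p,t}`, and `Ω_{p,t} = [Diag(e), B_p]` for some
vector `e`: this choice among the solutions makes `N_{p,t}` normal to `E_α`. -/
structure IsDiagonalLift (B : α.Blocks)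
    (u : ∀ i : Fin α.k, Fin (α.size i - 1) → Fin (α.size i) → ℝ)
    (Ω : ∀ i : Fin α.k, Fin (α.size i - 1) → Matrix (Fin (α.size i)) (Fin (α.size i)) ℝ) :
    Prop where
  exists_diagonal_lie_eq : ∀ p t, ∃ e : Fin (α.size p) → ℝ, ⁅diagonal e, B p⁆ = Ω p t
  diag_lie_eq : ∀ p t, ⁅B p, Ω p t⁆.diag = u p t

theorem exists_isDiagonalLift (hΛ : StronglyDisjoint Λ) (hB : α.IsCritical B)
    (hu : α.IsHyperplaneBasis u) : ∃ Ω, IsDiagonalLift B u Ω := by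
  have hker (p t) : u p t ∈ LinearMap.ker (levelMean (B p).diag) :=
    mem_ker_levelMean.2 fun i => by
      have hdiag : ∀ j, (B p).diag j = (B p).diag i := fun j =>
        ((hB p).2 j).trans ((hB p).2 i).symm
      rw [Finset.filter_true_of_mem fun j _ => hdiag j]
      exact (hu p).1 t
  choose e he using fun p t => (hΛ.subset (α.part_subset p)).exists_diag_lie_eq
    (hB.block_mem_critSet p) (hker p t)
  exact ⟨fun p t => ⁅diagonal (e p t), B p⁆, fun p t => ⟨e p t, rfl⟩, he⟩

namespace IsDiagonalLift

theorem isSkew (hΩ : IsDiagonalLift B u Ω) (hB : α.IsCritical B) (p : Fin α.k)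
    (t : Fin (α.size p - 1)) : IsSkew (Ω p t) := by
  obtain ⟨e, he⟩ := hΩ.exists_diagonal_lie_eq p t
  exact he ▸ isSkew_lie_of_symm (diagonal_transpose e) (hB p).1.1

theorem exists_diagVec_eq (hΩ : IsDiagonalLift B u Ω) (y : α.DiagIndex) :
    ∃ f : Fin Λ.card → ℝ, α.diagVec B Ω y = ⁅α.diag B, ⁅diagonal f, α.diag B⁆⁆ := by
  obtain ⟨e, he⟩ := hΩ.exists_diagonal_lie_eq y.1 y.2
  exact ⟨α.extend y.1 e, by
    rw [diagVec, ← he, diagonal_extend_lie_diag, diag_lie_diag_single]⟩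

theorem diagVec_mem_critNormal (hΩ : IsDiagonalLift B u Ω) (hB : α.IsCritical B)
    (y : α.DiagIndex) : α.diagVec B Ω y ∈ critNormal (α.diag B) := by
  obtain ⟨f, hf⟩ := hΩ.exists_diagVec_eq y
  exact hf ▸ lie_diagonal_lie_mem_critNormal hB.diag_mem_critSlice.1.1.1 f

theorem diag_diagVec (hΩ : IsDiagonalLift B u Ω) (y : α.DiagIndex) :
    (α.diagVec B Ω y).diag = α.extend y.1 (u y.1 y.2) := by
  rw [diagVec, diag_diag_single, hΩ.diag_lie_eq]

theorem hessian_diagVec (hΩ : IsDiagonalLift B u Ω) (hB : α.IsCritical B)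
    (hX : X ∈ isoTangent (α.diag B)) (y : α.DiagIndex) :
    hessian diagPotential (α.diag B) (α.diagVec B Ω y) X =
      α.extend y.1 (u y.1 y.2) ⬝ᵥ X.diag := by
  have hH := hB.diag_mem_critSlice.1
  have hcomm : ⁅diagonal (α.diag B).diag, α.diagVec B Ω y⁆ = 0 := by
    obtain ⟨f, hf⟩ := hΩ.exists_diagVec_eq y
    rw [hf, diagonal_lie_lie_diagonal_lie hH.2]
  rw [hessian_eq_dotProduct_diag hH
    (mem_isoTangent_of_mem_critNormal (hΩ.diagVec_mem_critNormal hB y)) hX hcomm, hΩ.diag_diagVec]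

theorem hessian_diagVec_diagVec (hΩ : IsDiagonalLift B u Ω) (hB : α.IsCritical B)
    (hu : α.IsHyperplaneBasis u) (y y' : α.DiagIndex) :
    hessian diagPotential (α.diag B) (α.diagVec B Ω y) (α.diagVec B Ω y') =
      if y = y' then 1 else 0 := by
  have htan := mem_isoTangent_of_mem_critNormal (hΩ.diagVec_mem_critNormal hB y')
  rw [hΩ.hessian_diagVec hB htan, hΩ.diag_diagVec, extend_dotProduct_extend]
  obtain ⟨p, t⟩ := y
  obtain ⟨q, t'⟩ := y'
  obtain rfl | hpq := eq_or_ne p q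
  · simp only [Pi.single_eq_same, (hu p).2, Sigma.mk.injEq, heq_eq_eq, true_and]
  · rw [Pi.single_eq_of_ne hpq, dotProduct_zero, if_neg fun h => hpq (congrArg Sigma.fst h)]

theorem hessian_diagVec_offVec {v : ∀ i : Fin α.k, Fin (α.size i) → Fin (α.size i) → ℝ}
    (hΩ : IsDiagonalLift B u Ω) (hΛ : StronglyDisjoint Λ) (hB : α.IsCritical B)
    (hv : α.IsUnitEigen B v) (y : α.DiagIndex) (x : α.OffIndex) :
    hessian diagPotential (α.diag B) (α.diagVec B Ω y) (α.offVec v x) = 0 := by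
  have htan := mem_isoTangent_of_mem_critNormal (offVec_mem_critNormal hΛ hB hv x)
  rw [hΩ.hessian_diagVec hB htan, diag_offVec hΛ hB hv, dotProduct_zero]

theorem hessian_offVec_diagVec {v : ∀ i : Fin α.k, Fin (α.size i) → Fin (α.size i) → ℝ}
    (hΩ : IsDiagonalLift B u Ω) (hΛ : StronglyDisjoint Λ) (hB : α.IsCritical B)
    (hv : α.IsUnitEigen B v) (x : α.OffIndex) (y : α.DiagIndex) :
    hessian diagPotential (α.diag B) (α.offVec v x) (α.diagVec B Ω y) = 0 := by
  have hH := hB.diag_mem_critSlice.1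
  rw [hessian_comm hH (mem_isoTangent_of_mem_critNormal (offVec_mem_critNormal hΛ hB hv x))
    (mem_isoTangent_of_mem_critNormal (hΩ.diagVec_mem_critNormal hB y)),
    hΩ.hessian_diagVec_offVec hΛ hB hv]

theorem diag_eq_zero (hΩ : IsDiagonalLift B u Ω) (hB : α.IsCritical B)
    (hu : α.IsHyperplaneBasis u) (hX : X ∈ isoTangent (α.diag B))
    (hzero : ∀ y, hessian diagPotential (α.diag B) (α.diagVec B Ω y) X = 0) : X.diag = 0 := by
  ext x
  obtain ⟨⟨p, a⟩, rfl⟩ := α.blockEquiv.surjective x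
  have hsum : α.extend p 1 ⬝ᵥ X.diag = 0 := by
    obtain ⟨M, -, rfl⟩ := hX
    have hone : ⁅diagonal (1 : Fin (α.size p) → ℝ), B p⁆ = 0 := by
      rw [diagonal_one', Ring.lie_def, one_mul, mul_one, sub_self]
    rw [dotProduct_diag_lie, diagonal_extend_lie_diag, hone, Pi.single_zero, diag,
      blockDiagonal'_zero, reindex_apply, submatrix_zero, Pi.zero_apply, Pi.zero_apply,
      Matrix.zero_mul, trace_zero]
  rw [extend_dotProduct, one_dotProduct] at hsum
  refine congrFun (eq_zero_of_orthogonal_hyperplane_basis (α.nonempty p).card_pos (hu p).1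
    (hu p).2 hsum fun t => ?_) a
  rw [← extend_dotProduct, ← hΩ.hessian_diagVec hB hX ⟨p, t⟩, hzero]

end IsDiagonalLift

end DiagVec

theorem linearIndependent_and_span_hessianBasis {B : α.Blocks}
    {v : ∀ i : Fin α.k, Fin (α.size i) → Fin (α.size i) → ℝ}
    {u : ∀ i : Fin α.k, Fin (α.size i - 1) → Fin (α.size i) → ℝ}
    {Ω : ∀ i : Fin α.k, Fin (α.size i - 1) → Matrix (Fin (α.size i)) (Fin (α.size i)) ℝ}
    (hΛ : StronglyDisjoint Λ) (hB : α.IsCritical B) (hv : α.IsUnitEigen B v)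
    (hu : α.IsHyperplaneBasis u) (hΩ : IsDiagonalLift B u Ω) :
    LinearIndependent ℝ (Sum.elim (α.offVec v) (α.diagVec B Ω)) ∧
      Submodule.span ℝ (Set.range (Sum.elim (α.offVec v) (α.diagVec B Ω))) =
        critNormal (α.diag B) := by
  have hH := hB.diag_mem_critSlice.1
  have hoff := offVec_mem_critNormal hΛ hB hv
  have hdiag := hΩ.diagVec_mem_critNormal hB
  refine linearIndependent_and_span_eq_critNormal hH (Sum.rec hoff hdiag) ?_ ?_ fun X hX hzero => ?_
  · rintro (x | y) (x' | y') hne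
    · exact (hessian_offVec_offVec hΛ hB hv x x').trans (if_neg (ne_of_apply_ne _ hne))
    · exact hΩ.hessian_offVec_diagVec hΛ hB hv x y'
    · exact hΩ.hessian_diagVec_offVec hΛ hB hv y x'
    · exact (hΩ.hessian_diagVec_diagVec hB hu y y').trans (if_neg (ne_of_apply_ne _ hne))
  · rintro (x | y)
    · exact hessian_offVec_self_ne_zero hΛ hB hv x
    · exact ((hΩ.hessian_diagVec_diagVec hB hu y y).trans (if_pos rfl)).trans_ne one_ne_zero
  · have htan := mem_isoTangent_of_mem_critNormal hX
    refine eq_zero_of_mem_critNormal hX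
      (diagonal_diag_lie_eq_zero hΛ hB hv htan fun x => hzero (Sum.inl x))
      (hΩ.diag_eq_zero hB hu htan fun y => ?_)
    rw [hessian_comm hH (mem_isoTangent_of_mem_critNormal (hdiag y)) htan]
    exact hzero (Sum.inr y)

end OrderedPartition

end DiagPotential

theorem mainTheorem3 (Λ : Finset ℝ) (hΛ : StronglyDisjoint Λ) :
    -- nondegeneracy on the normal space at every point of every `E_α`
    (∀ α : OrderedPartition Λ, ∀ H ∈ α.E,
      NondegenerateOn (hessian diagPotential H) (normalSpace α.E H)) ∧
    -- the explicit basis of the normal space that is orthogonal for the Hessian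
    (∀ (α : OrderedPartition Λ) (B : α.Blocks), α.IsCritical B →
      ∀ v, α.IsUnitEigen B v → ∀ u, α.IsHyperplaneBasis u →
      ∃ Ω : ∀ i : Fin α.k, Fin (α.size i - 1) → Matrix (Fin (α.size i)) (Fin (α.size i)) ℝ,
        (∀ i j, IsSkew (Ω i j) ∧ ∀ a, ⁅B i, Ω i j⁆ a a = u i j a) ∧
        LinearIndependent ℝ (Sum.elim (α.offVec v) (α.diagVec B Ω)) ∧
        (Submodule.span ℝ (Set.range (Sum.elim (α.offVec v) (α.diagVec B Ω))) : Set (Mat Λ)) =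
          normalSpace α.E (α.diag B) ∧
        (∀ x x', x ≠ x' →
          hessian diagPotential (α.diag B) (α.offVec v x) (α.offVec v x') = 0) ∧
        (∀ x : α.OffIndex,
          hessian diagPotential (α.diag B) (α.offVec v x) (α.offVec v x) =
            -2 * (α.eig x.1.1.1 x.2.1 - α.eig x.1.1.2 x.2.2) *
              (mean (α.part x.1.1.1) - mean (α.part x.1.1.2)) ∧
          hessian diagPotential (α.diag B) (α.offVec v x) (α.offVec v x) ≠ 0) ∧
        (∀ y y', hessian diagPotential (α.diag B) (α.diagVec B Ω y) (α.diagVec B Ω y') =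
          if y = y' then 1 else 0) ∧
        (∀ x y,
          hessian diagPotential (α.diag B) (α.offVec v x) (α.diagVec B Ω y) = 0 ∧
          hessian diagPotential (α.diag B) (α.diagVec B Ω y) (α.offVec v x) = 0)) ∧
    -- invariance of the Hessian under conjugation by permutation matrices
    (∀ (σ : Equiv.Perm (Fin Λ.card)), ∀ H ∈ isoSym Λ,
      permConj σ H ∈ isoSym Λ ∧
      ∀ X ∈ isoTangent H, ∀ Y ∈ isoTangent H,
        permConj σ X ∈ isoTangent (permConj σ H) ∧
        hessian diagPotential (permConj σ H) (permConj σ X) (permConj σ Y) =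
          hessian diagPotential H X Y) ∧
    -- nondegeneracy on the normal space along every critical manifold in the orbit of an `E_α`
    (∀ (α : OrderedPartition Λ) (σ : Equiv.Perm (Fin Λ.card)), ∀ H ∈ permConj σ '' α.E,
      NondegenerateOn (hessian diagPotential H) (normalSpace (permConj σ '' α.E) H)) ∧
    -- the diagonal potential is a Morse-Bott function
    IsMorseBott Λ diagPotential := by
  have hE (α : OrderedPartition Λ) := α.E_eq_critSlice hΛ
  refine ⟨fun α H hH => ?_, fun α B hB v hv u hu => ?_,
    fun σ H hH => ⟨permConj_mem_isoSym σ hH, fun X hX Y hY =>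
      ⟨permConj_mem_isoTangent σ hX, hessian_permConj σ hH hX hY⟩⟩,
    fun α σ H hH => ?_, isMorseBott_diagPotential hΛ⟩
  · rw [hE] at hH ⊢
    exact nondegenerateOn_normalSpace hΛ hH.1 (eventually_mem_critSlice_iff hH.2)
  · obtain ⟨Ω, hΩ⟩ := OrderedPartition.exists_isDiagonalLift hΛ hB hu
    obtain ⟨hli, hspan⟩ := OrderedPartition.linearIndependent_and_span_hessianBasis hΛ hB hv hu hΩ
    have hH := hB.diag_mem_critSlice
    have hoff := OrderedPartition.hessian_offVec_offVec hΛ hB hv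
    refine ⟨Ω, fun p t => ⟨hΩ.isSkew hB p t, congrFun (hΩ.diag_lie_eq p t)⟩, hli, ?_,
      fun x x' hne => (hoff x x').trans (if_neg hne),
      fun x => ⟨(hoff x x).trans (if_pos rfl),
        OrderedPartition.hessian_offVec_self_ne_zero hΛ hB hv x⟩,
      hΩ.hessian_diagVec_diagVec hB hu, fun x y =>
        ⟨hΩ.hessian_offVec_diagVec hΛ hB hv x y, hΩ.hessian_diagVec_offVec hΛ hB hv y x⟩⟩
    rw [hspan, hE, normalSpace_eq_critNormal hΛ hH.1 (eventually_mem_critSlice_iff hH.2)]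
  · rw [hE, image_permConj_critSlice] at hH ⊢
    exact nondegenerateOn_normalSpace hΛ hH.1 (eventually_mem_critSlice_iff hH.2)
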